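/- Let $A$ be a real Banach lattice algebra with identity $e$: a Banach lattice with a product making it a Banach algebra in which products of positive elements are positive, with a multiplicative identity $e$ such that $\|e\|=1$. Let $A_{\mathbb C}=\{x+iy : x,y\in A\}$ be its complexification, with the natural product, the modulus $|x+iy|=\sup_{0\le\varphi\le 2\pi}(x\cos\varphi+y\sin\varphi)$ and the norm $\|z\|=\|\,|z|\,\|$. An ideal of $A_{\mathbb C}$ is a complex subspace $I$ such that $z\in I$ and $|w|\le|z|$ imply $w\in I$; it is a projection band if $I\cap A$ is a projection band of $A$, that is, if $I\cap A$ is a band of $A$ with $A=(I\cap A)\oplus (I\cap A)^{d}$. Let $(A_{\mathbb C})_e$ be the intersection of all ideals of $A_{\mathbb C}$ containing $e$, let $A_e$ be the intersection of all (real, solid) ideals of $A$ containing $e$, and put $\|z\|_e=\inf\{\lambda>0 : |z|\le\lambda e\}$ for $z\in (A_{\mathbb C})_e$. Then $(A_{\mathbb C})_e=(A_e)_{\mathbb C}=\{x+iy : x,y\in A_e\}$, and moreover: (i) there are a compact Hausdorff space $K$ and a complex algebra isomorphism $\Phi\colon (A_{\mathbb C})_e\to C(K,\mathbb C)$ with $\|\Phi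 z\|_\infty=\|z\|$ and $\Phi(|z|)=|\Phi(z)|$ for all $z\in(A_{\mathbb C})_e$; moreover $\|z\|=\|z\|_e=r(z)$ for all $z\in (A_{\mathbb C})_e$, where $r(z)$ is the spectral radius of $z$ in $A_{\mathbb C}$; (ii) $(A_{\mathbb C})_e$ is a projection band in $A_{\mathbb C}$; (iii) $(A_{\mathbb C})_e$ is an inverse closed subalgebra of $A_{\mathbb C}$: if $b\in (A_{\mathbb C})_e$ is invertible in $A_{\mathbb C}$, then $b^{-1}\in (A_{\mathbb C})_e$. -/

import Mathlib

universe u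

/-- A real Banach lattice: a complete normed space and vector lattice whose norm is solid. -/
class IsBanachLattice (X : Type*) [NormedAddCommGroup X] [NormedSpace ℝ X] [Lattice X] : Prop
    extends IsOrderedAddMonoid X, PosSMulMono ℝ X, HasSolidNorm X, CompleteSpace X

/-- A real Banach lattice algebra: a Banach lattice and Banach algebra in which products of
positive elements are positive. An identity of norm one is expressed by `NormOneClass`; its
positivity is not assumed. -/
class IsBanachLatticeAlgebra (A : Type*) [NormedRing A] [NormedAlgebra ℝ A] [Lattice A] : Prop
    extends IsBanachLattice A where
  protected mul_nonneg : ∀ x y : A, 0 ≤ x → 0 ≤ y → 0 ≤ x * y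

/-! ### Ideals and bands in a real vector lattice -/

namespace RealLattice

section

variable {X : Type*} [AddCommGroup X] [Module ℝ X] [Lattice X]

/-- A (lattice) ideal: a solid subspace. Being solid, it is closed under `|·|`. -/
def IsIdeal (B : Submodule ℝ X) : Prop :=
  LatticeOrderedAddCommGroup.IsSolid (B : Set X)

/-- The ideal generated by `x`: the intersection of all the ideals containing `x`. -/
def idealGen (x : X) : Submodule ℝ X :=
  sInf {B | IsIdeal B ∧ x ∈ B}

/-- A band: an ideal containing the supremum, when it exists, of each of its upwards directed
nonempty subsets. -/
def IsBand (B : Submodule ℝ X) : Prop :=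
  IsIdeal B ∧ ∀ D : Set X, D ⊆ B → D.Nonempty → DirectedOn (· ≤ ·) D →
    ∀ s : X, IsLUB D s → s ∈ B

/-- The disjoint complement of `B`. -/
def disjointCompl (B : Submodule ℝ X) : Set X :=
  {x | ∀ y ∈ B, |x| ⊓ |y| = 0}

/-- A projection band: a band `B` such that `X` is the direct sum of `B` and its disjoint
complement. -/
def IsProjectionBand (B : Submodule ℝ X) : Prop :=
  IsBand B ∧ ∀ x : X, ∃! p : X × X, p.1 ∈ B ∧ p.2 ∈ disjointCompl B ∧ p.1 + p.2 = x

/-- The norm `inf {c > 0 : |x| ≤ c e}` on the ideal generated by `e`. -/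
noncomputable def unitNorm (e x : X) : ℝ :=
  sInf {c : ℝ | 0 < c ∧ |x| ≤ c • e}

end

end RealLattice

/-! ### The complexification -/

/-- The complexification of `X`; the pair `⟨x, y⟩` stands for `x + i y`. -/
@[ext]
structure Complexification (X : Type*) where
  re : X
  im : X

namespace Complexification

section Linear

variable {X : Type*} [AddCommGroup X]

instance : Zero (Complexification X) := ⟨⟨0, 0⟩⟩
instance : Add (Complexification X) := ⟨fun z w => ⟨z.re + w.re, z.im + w.im⟩⟩
instance : Neg (Complexification X) := ⟨fun z => ⟨-z.re, -z.im⟩⟩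
instance : Sub (Complexification X) := ⟨fun z w => ⟨z.re - w.re, z.im - w.im⟩⟩

@[simp] theorem zero_re : (0 : Complexification X).re = 0 := rfl
@[simp] theorem zero_im : (0 : Complexification X).im = 0 := rfl
@[simp] theorem add_re (z w : Complexification X) : (z + w).re = z.re + w.re := rfl
@[simp] theorem add_im (z w : Complexification X) : (z + w).im = z.im + w.im := rfl
@[simp] theorem neg_re (z : Complexification X) : (-z).re = -z.re := rfl
@[simp] theorem neg_im (z : Complexification X) : (-z).im = -z.im := rfl
@[simp] theorem sub_re (z w : Complexification X) : (z - w).re = z.re - w.re := rfl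
@[simp] theorem sub_im (z w : Complexification X) : (z - w).im = z.im - w.im := rfl

instance : AddCommGroup (Complexification X) where
  add_assoc a b c := by ext <;> simp [add_assoc]
  zero_add a := by ext <;> simp
  add_zero a := by ext <;> simp
  add_comm a b := by ext <;> simp [add_comm]
  neg_add_cancel a := by ext <;> simp
  sub_eq_add_neg a b := by ext <;> simp [sub_eq_add_neg]
  nsmul := nsmulRec
  zsmul := zsmulRec

/-- The inclusion of `X` in its complexification. -/
def ofReal (x : X) : Complexification X := ⟨x, 0⟩

@[simp] theorem ofReal_re (x : X) : (ofReal x).re = x := rfl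
@[simp] theorem ofReal_im (x : X) : (ofReal x).im = 0 := rfl

variable [Module ℝ X]

instance : SMul ℂ (Complexification X) :=
  ⟨fun c z => ⟨c.re • z.re - c.im • z.im, c.re • z.im + c.im • z.re⟩⟩

@[simp] theorem smul_re (c : ℂ) (z : Complexification X) :
    (c • z).re = c.re • z.re - c.im • z.im := rfl
@[simp] theorem smul_im (c : ℂ) (z : Complexification X) :
    (c • z).im = c.re • z.im + c.im • z.re := rfl

instance : Module ℂ (Complexification X) where
  one_smul z := by ext <;> simp
  mul_smul a b z := by
    ext <;> simp only [smul_re, smul_im, Complex.mul_re, Complex.mul_im] <;> module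
  smul_zero a := by ext <;> simp
  smul_add a z w := by
    ext <;> simp only [smul_re, smul_im, add_re, add_im] <;> module
  add_smul a b z := by
    ext <;> simp only [smul_re, smul_im, add_re, add_im, Complex.add_re, Complex.add_im] <;>
      module
  zero_smul z := by ext <;> simp

/-- The complexification of a real subspace, as a subspace of the complexification. -/
def ofSubmodule (B : Submodule ℝ X) : Submodule ℂ (Complexification X) where
  carrier := {z | z.re ∈ B ∧ z.im ∈ B}
  add_mem' hz hw := ⟨B.add_mem hz.1 hw.1, B.add_mem hz.2 hw.2⟩
  zero_mem' := ⟨B.zero_mem, B.zero_mem⟩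
  smul_mem' c _ hz :=
    ⟨B.sub_mem (B.smul_mem c.re hz.1) (B.smul_mem c.im hz.2),
      B.add_mem (B.smul_mem c.re hz.2) (B.smul_mem c.im hz.1)⟩

/-- The intersection of a complex subspace with `X`. -/
def interReal (B : Submodule ℂ (Complexification X)) : Submodule ℝ X where
  carrier := {x | ofReal x ∈ B}
  add_mem' {x y} hx hy := by
    have h : ofReal (x + y) = ofReal x + ofReal y := by ext <;> simp
    show ofReal (x + y) ∈ B
    exact h ▸ B.add_mem hx hy
  zero_mem' := B.zero_mem
  smul_mem' c x hx := by
    have h : ofReal (c • x) = (c : ℂ) • ofReal x := by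
      ext <;> simp only [smul_re, smul_im, ofReal_re, ofReal_im, Complex.ofReal_re,
        Complex.ofReal_im] <;> module
    show ofReal (c • x) ∈ B
    exact h ▸ B.smul_mem (c : ℂ) hx

end Linear

section Algebra

variable {A : Type*} [Ring A]

instance : One (Complexification A) := ⟨⟨1, 0⟩⟩
instance : Mul (Complexification A) :=
  ⟨fun z w => ⟨z.re * w.re - z.im * w.im, z.re * w.im + z.im * w.re⟩⟩

@[simp] theorem one_re : (1 : Complexification A).re = 1 := rfl
@[simp] theorem one_im : (1 : Complexification A).im = 0 := rfl
@[simp] theorem mul_re (z w : Complexification A) :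
    (z * w).re = z.re * w.re - z.im * w.im := rfl
@[simp] theorem mul_im (z w : Complexification A) :
    (z * w).im = z.re * w.im + z.im * w.re := rfl

instance : Ring (Complexification A) where
  __ := (inferInstance : AddCommGroup (Complexification A))
  left_distrib a b c := by ext <;> simp <;> noncomm_ring
  right_distrib a b c := by ext <;> simp <;> noncomm_ring
  zero_mul a := by ext <;> simp
  mul_zero a := by ext <;> simp
  mul_assoc a b c := by ext <;> simp <;> noncomm_ring
  one_mul a := by ext <;> simp
  mul_one a := by ext <;> simp

instance [Algebra ℝ A] : Algebra ℂ (Complexification A) :=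
  Algebra.ofModule
    (fun c z w => by
      ext <;> simp only [smul_re, smul_im, mul_re, mul_im, sub_mul, add_mul, smul_mul_assoc] <;>
        module)
    (fun c z w => by
      ext <;> simp only [smul_re, smul_im, mul_re, mul_im, mul_sub, mul_add, mul_smul_comm] <;>
        module)

end Algebra

section Modulus

variable {X : Type*} [NormedAddCommGroup X] [NormedSpace ℝ X] [Lattice X]

/-- The set `{x cos φ + y sin φ : 0 ≤ φ ≤ 2π}` whose supremum is the modulus of `x + i y`. -/
def rotations (z : Complexification X) : Set X :=
  (fun φ : ℝ => Real.cos φ • z.re + Real.sin φ • z.im) '' Set.Icc 0 (2 * Real.pi)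

variable [IsBanachLattice X]

theorem exists_isLUB_rotations (z : Complexification X) : ∃ s, IsLUB (rotations z) s := by
  set f : ℝ → X := fun φ => Real.cos φ • z.re + Real.sin φ • z.im with hf
  set u : X := |z.re| + |z.im| with hu
  have hu0 : 0 ≤ u := add_nonneg (abs_nonneg _) (abs_nonneg _)
  have hsm : ∀ (a b : ℝ) (x : X), |a| ≤ b → a • x ≤ b • |x| := by
    intro a b x hab
    have h1 : a • x ≤ |a| • |x| := by
      rcases le_total 0 a with ha | ha
      · rw [abs_of_nonneg ha]
        exact smul_le_smul_of_nonneg_left (le_abs_self x) ha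
      · rw [abs_of_nonpos ha, ← neg_smul_neg a x]
        exact smul_le_smul_of_nonneg_left (neg_le_abs x) (neg_nonneg.2 ha)
    have h2 : 0 ≤ (b - |a|) • |x| := smul_nonneg (sub_nonneg.2 hab) (abs_nonneg x)
    rw [sub_smul, sub_nonneg] at h2
    exact h1.trans h2
  have hlip : ∀ (φ ψ d : ℝ), |φ - ψ| ≤ d → f φ ≤ f ψ + d • u := by
    intro φ ψ d hd
    have h1 := hsm _ _ z.re ((Real.abs_cos_sub_cos_le φ ψ).trans hd)
    have h2 := hsm _ _ z.im ((Real.abs_sin_sub_sin_le φ ψ).trans hd)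
    have h3 : f φ - f ψ ≤ d • u := by
      have : f φ - f ψ = (Real.cos φ - Real.cos ψ) • z.re + (Real.sin φ - Real.sin ψ) • z.im := by
        simp only [hf]; module
      rw [this, hu, smul_add]
      exact add_le_add h1 h2
    rw [add_comm]
    exact sub_le_iff_le_add.1 h3
  let g : ℕ → ℕ → ℝ := fun n k => 2 * Real.pi * k / (n + 1)
  let e : ℕ → ℝ := fun n => 2 * Real.pi / (n + 1)
  have hpi : 0 < 2 * Real.pi := by positivity
  have he0 : ∀ n, 0 ≤ e n := fun n => by positivity
  let s : ℕ → X := fun n =>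
    (Finset.range (n + 2)).sup' ⟨0, Finset.mem_range.2 (by omega)⟩ (fun k => f (g n k))
  have hg : ∀ n, ∀ k ∈ Finset.range (n + 2), g n k ∈ Set.Icc 0 (2 * Real.pi) := by
    intro n k hk
    have hk' : (k : ℝ) ≤ n + 1 := by
      have := Finset.mem_range.1 hk
      exact_mod_cast (by omega : k ≤ n + 1)
    refine ⟨by positivity, ?_⟩
    rw [div_le_iff₀ (by positivity)]
    exact mul_le_mul_of_nonneg_left hk' hpi.le
  have hup : ∀ n, ∀ φ ∈ Set.Icc 0 (2 * Real.pi), f φ ≤ s n + e n • u := by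
    intro n φ hφ
    have hn : (0 : ℝ) < n + 1 := by positivity
    have hq : 0 ≤ φ * (n + 1) / (2 * Real.pi) := by
      have := hφ.1
      positivity
    set k := ⌊φ * (n + 1) / (2 * Real.pi)⌋₊ with hk
    have hk1 : (k : ℝ) ≤ φ * (n + 1) / (2 * Real.pi) := Nat.floor_le hq
    have hk2 : φ * (n + 1) / (2 * Real.pi) < k + 1 := Nat.lt_floor_add_one _
    have hkn : k ∈ Finset.range (n + 2) := by
      have h : (k : ℝ) ≤ ((n + 1 : ℕ) : ℝ) := by
        refine hk1.trans ?_
        rw [div_le_iff₀ hpi, mul_comm]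
        push_cast
        exact mul_le_mul_of_nonneg_left hφ.2 hn.le
      have : k ≤ n + 1 := by exact_mod_cast h
      exact Finset.mem_range.2 (by omega)
    rw [le_div_iff₀ hpi] at hk1
    rw [div_lt_iff₀ hpi] at hk2
    have hd : |φ - g n k| ≤ e n := by
      have h1 : g n k ≤ φ := by
        rw [div_le_iff₀ hn]; linarith
      have h2 : φ ≤ g n k + e n := by
        have : g n k + e n = (2 * Real.pi * k + 2 * Real.pi) / (n + 1) := by
          simp only [g, e]; ring
        rw [this, le_div_iff₀ hn]; linarith
      rw [abs_of_nonneg (by linarith)]; linarith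
    refine (hlip _ _ _ hd).trans (add_le_add ?_ le_rfl)
    exact Finset.le_sup' (fun k => f (g n k)) hkn
  have hss : ∀ m n, s m ≤ s n + e n • u := fun m n =>
    Finset.sup'_le _ _ fun k hk => hup n _ (hg m k hk)
  have het : Filter.Tendsto e Filter.atTop (nhds 0) :=
    (tendsto_const_div_atTop_nhds_zero_nat (2 * Real.pi)).comp (Filter.tendsto_add_atTop_nat 1)
      |>.congr fun n => by simp [e]
  have hcau : CauchySeq s := by
    refine cauchySeq_of_le_tendsto_0' (fun n => e n * ‖u‖) (fun n m hnm => ?_)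
      (by simpa using het.mul_const ‖u‖)
    have hem : e m ≤ e n := by
      have : (n : ℝ) ≤ m := by exact_mod_cast hnm
      simp only [e]
      gcongr
    have h0 : 0 ≤ e n • u := smul_nonneg (he0 n) hu0
    have h1 : s n - s m ≤ e n • u := by
      refine (sub_le_iff_le_add'.2 (hss n m)).trans ?_
      have : 0 ≤ (e n - e m) • u := smul_nonneg (sub_nonneg.2 hem) hu0
      rwa [sub_smul, sub_nonneg] at this
    have h2 : -(s n - s m) ≤ e n • u := by
      rw [neg_sub]
      exact sub_le_iff_le_add'.2 (hss m n)
    have h3 : |s n - s m| ≤ |e n • u| := by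
      rw [abs_of_nonneg h0]
      exact abs_le'.2 ⟨h1, h2⟩
    calc dist (s n) (s m) = ‖s n - s m‖ := dist_eq_norm _ _
      _ ≤ ‖e n • u‖ := HasSolidNorm.solid h3
      _ = e n * ‖u‖ := by rw [norm_smul, Real.norm_of_nonneg (he0 n)]
  obtain ⟨l, hl⟩ := cauchySeq_tendsto_of_complete hcau
  refine ⟨l, ?_, ?_⟩
  · rintro _ ⟨φ, hφ, rfl⟩
    have h : Filter.Tendsto (fun n => s n + e n • u) Filter.atTop (nhds l) := by
      simpa using hl.add (het.smul_const u)
    exact ge_of_tendsto' h fun n => hup n φ hφ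
  · intro b hb
    exact le_of_tendsto' hl fun n =>
      Finset.sup'_le _ _ fun k hk => hb ⟨_, hg n k hk, rfl⟩

/-- The modulus `|z| = sup {x cos φ + y sin φ : 0 ≤ φ ≤ 2π}` of `z = x + i y`. -/
noncomputable def modulus (z : Complexification X) : X :=
  Classical.choose (exists_isLUB_rotations z)

theorem isLUB_modulus (z : Complexification X) : IsLUB (rotations z) (modulus z) :=
  Classical.choose_spec (exists_isLUB_rotations z)

/-- The norm `‖z‖ = ‖|z|‖` of the complexification. -/
noncomputable instance : Norm (Complexification X) := ⟨fun z => ‖modulus z‖⟩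

/-- An ideal of the complexification: a complex subspace that contains `w` as soon as it contains
some `z` with `|w| ≤ |z|`. -/
def IsIdeal (I : Submodule ℂ (Complexification X)) : Prop :=
  ∀ z ∈ I, ∀ w : Complexification X, modulus w ≤ modulus z → w ∈ I

/-- The ideal generated by `z`: the intersection of all the ideals containing `z`. -/
noncomputable def idealGen (z : Complexification X) : Submodule ℂ (Complexification X) :=
  sInf {I | IsIdeal I ∧ z ∈ I}

/-- A projection band of the complexification: an ideal whose intersection with `X` is a
projection band of `X`. -/
def IsProjectionBand (B : Submodule ℂ (Complexification X)) : Prop :=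
  IsIdeal B ∧ RealLattice.IsProjectionBand (interReal B)

end Modulus

end Complexification

/-- A subalgebra is inverse closed if it contains the inverse of each of its elements that is
invertible in the whole algebra. -/
def Subalgebra.IsInverseClosed {R A : Type*} [CommSemiring R] [Ring A] [Algebra R A]
    (S : Subalgebra R A) : Prop :=
  ∀ u : Aˣ, (u : A) ∈ S → ((u⁻¹ : Aˣ) : A) ∈ S

/-! Everything rests on the elements `x` with `|x| ≤ c • 1`, which form the ideal generated by the
identity, `unitIdeal`. The identity is positive: powers of `|1|` dominate growing multiples of `1⁻`
but stay bounded in norm. If `a, b ≥ 0` lie in the ideal, `a * b` is dominated by multiples of both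
`a` and `b`, so disjoint elements have product zero and squares are positive.

Positive squares give Bernoulli's inequality `1 + n (x - 1) ≤ x ^ n`. If `‖x‖ ≤ 1` the powers are
bounded, and the Archimedean property forces `x ≤ 1`. Hence `|x| ≤ ‖x‖ • 1`
(`abs_le_norm_smul_one`): the norm on the ideal is the order unit norm. Closedness of the ideal and
the projection `x ⊓ ‖x‖ • 1` for `x ≥ 0` both follow from this.

Commutativity comes from Bernstein polynomials: the square of a commutator `x * y - y * x` is
bounded by a multiple of `(x - a)²` for every real `a`, and averaging over `a = ν / n` with
Bernstein weights in `x` makes the bound `O(1 / n)`.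

The ideal is thus a complete commutative order unit algebra with positive squares. Its
complexification is a commutative C⋆-algebra for the norm `√‖x² + y²‖`, and Gelfand duality
represents it as `C(K, ℂ)`. The representation preserves order, hence the modulus and the lattice
norm. A peaking function at a zero of `f` shows that `f` cannot come from an element invertible in
the whole algebra; this gives inverse closedness, and with it the spectral radius. -/

/-! ### Order unit algebras -/

/-- A commutative real normed algebra ordered by a cone containing the squares, whose norm is the
order unit norm of the identity. -/
class IsOrderUnitAlgebra (B : Type*) [NormedCommRing B] [NormedAlgebra ℝ B] [PartialOrder B] : Prop
    extends IsOrderedRing B where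
  protected sq_nonneg : ∀ x : B, 0 ≤ x ^ 2
  norm_le_iff : ∀ (x : B) (c : ℝ), 0 ≤ c →
    (‖x‖ ≤ c ↔ -algebraMap ℝ B c ≤ x ∧ x ≤ algebraMap ℝ B c)

namespace IsOrderUnitAlgebra

variable {B : Type*} [NormedCommRing B] [NormedAlgebra ℝ B] [PartialOrder B] [IsOrderUnitAlgebra B]

theorem algebraMap_nonneg {c : ℝ} (hc : 0 ≤ c) : 0 ≤ algebraMap ℝ B c := by
  have := IsOrderUnitAlgebra.sq_nonneg (algebraMap ℝ B √c)
  rwa [← map_pow, Real.sq_sqrt hc] at this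

theorem nonneg_of_algebraMap_mul_nonneg {c : ℝ} (hc : 0 < c) {x : B}
    (h : 0 ≤ algebraMap ℝ B c * x) : 0 ≤ x := by
  have := mul_nonneg (algebraMap_nonneg (B := B) (inv_nonneg.2 hc.le)) h
  rwa [← mul_assoc, ← map_mul, inv_mul_cancel₀ hc.ne', map_one, one_mul] at this

theorem norm_le_iff_of_nonneg {x : B} (hx : 0 ≤ x) {c : ℝ} (hc : 0 ≤ c) :
    ‖x‖ ≤ c ↔ x ≤ algebraMap ℝ B c := by
  rw [norm_le_iff x c hc, and_iff_right]
  exact (neg_nonpos.2 (algebraMap_nonneg hc)).trans hx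

/-- Divide the identity `2a (a - x) = (x - a)² + (a² - x²)` by `2a > 0`. -/
theorem le_of_sq_le_of_pos {x : B} {a : ℝ} (ha : 0 < a) (h : x ^ 2 ≤ algebraMap ℝ B (a ^ 2)) :
    x ≤ algebraMap ℝ B a := by
  rw [← sub_nonneg]
  refine nonneg_of_algebraMap_mul_nonneg (c := 2 * a) (by positivity) ?_
  have := add_nonneg (IsOrderUnitAlgebra.sq_nonneg (x - algebraMap ℝ B a)) (sub_nonneg.2 h)
  convert this using 1
  simp only [map_mul, map_pow, map_ofNat]
  ring

theorem norm_le_of_sq_le {x : B} {a : ℝ} (ha : 0 ≤ a) (h : x ^ 2 ≤ algebraMap ℝ B (a ^ 2)) :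
    ‖x‖ ≤ a := by
  refine le_of_forall_pos_le_add fun ε hε => ?_
  have h' : x ^ 2 ≤ algebraMap ℝ B ((a + ε) ^ 2) := by
    refine h.trans ?_
    rw [← sub_nonneg, ← map_sub]
    exact algebraMap_nonneg (by nlinarith)
  rw [norm_le_iff x _ (by positivity)]
  exact ⟨neg_le.1 (le_of_sq_le_of_pos (by positivity) (by rwa [neg_sq])),
    le_of_sq_le_of_pos (by positivity) h'⟩

end IsOrderUnitAlgebra

/-! ### The C⋆-norm and Gelfand duality for order unit algebras -/

namespace Complexification

section OrderUnit

open IsOrderUnitAlgebra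

variable {B : Type*} [NormedCommRing B]

/-- The square `x ^ 2 + y ^ 2` of the modulus of `x + i y`. -/
def modulusSq (z : Complexification B) : B := z.re ^ 2 + z.im ^ 2

theorem modulusSq_mul (z w : Complexification B) :
    modulusSq (z * w) = modulusSq z * modulusSq w := by
  simp only [modulusSq, mul_re, mul_im]; ring

/-- The C⋆-norm on the complexification of an order unit algebra. -/
noncomputable def cstarNorm (z : Complexification B) : ℝ := √‖modulusSq z‖

theorem cstarNorm_nonneg (z : Complexification B) : 0 ≤ cstarNorm z := Real.sqrt_nonneg _

theorem cstarNorm_le_add (z : Complexification B) : cstarNorm z ≤ ‖z.re‖ + ‖z.im‖ := by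
  rw [cstarNorm, Real.sqrt_le_left (by positivity)]
  have h1 := norm_add_le (z.re ^ 2) (z.im ^ 2)
  have h2 := norm_pow_le' z.re two_pos
  have h3 := norm_pow_le' z.im two_pos
  unfold modulusSq
  nlinarith [norm_nonneg z.re, norm_nonneg z.im]

variable [NormedAlgebra ℝ B]

theorem modulusSq_smul (c : ℂ) (z : Complexification B) :
    modulusSq (c • z) = (‖c‖ ^ 2) • modulusSq z := by
  rw [← Complex.normSq_eq_norm_sq, Complex.normSq_apply]
  simp only [modulusSq, smul_re, smul_im]
  simp only [Algebra.smul_def, map_add, map_mul]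
  ring

theorem ofReal_algebraMap (c : ℝ) :
    ofReal (algebraMap ℝ B c) = algebraMap ℂ (Complexification B) c := by
  rw [Algebra.algebraMap_eq_smul_one, Algebra.algebraMap_eq_smul_one]
  ext <;> simp only [ofReal_re, ofReal_im, smul_re, smul_im, one_re, one_im, Complex.ofReal_re,
    Complex.ofReal_im] <;> module

variable [PartialOrder B] [IsOrderUnitAlgebra B]

theorem modulusSq_nonneg (z : Complexification B) : 0 ≤ modulusSq z :=
  add_nonneg (IsOrderUnitAlgebra.sq_nonneg _) (IsOrderUnitAlgebra.sq_nonneg _)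

theorem cstarNorm_le_iff {z : Complexification B} {a : ℝ} (ha : 0 ≤ a) :
    cstarNorm z ≤ a ↔ modulusSq z ≤ algebraMap ℝ B (a ^ 2) := by
  rw [cstarNorm, Real.sqrt_le_left ha, norm_le_iff_of_nonneg (modulusSq_nonneg z) (by positivity)]

theorem modulusSq_le (z : Complexification B) :
    modulusSq z ≤ algebraMap ℝ B (cstarNorm z ^ 2) :=
  (cstarNorm_le_iff (cstarNorm_nonneg z)).1 le_rfl

theorem norm_re_le_cstarNorm (z : Complexification B) : ‖z.re‖ ≤ cstarNorm z :=
  norm_le_of_sq_le (cstarNorm_nonneg z)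
    ((le_add_of_nonneg_right (IsOrderUnitAlgebra.sq_nonneg _)).trans (modulusSq_le z))

theorem norm_im_le_cstarNorm (z : Complexification B) : ‖z.im‖ ≤ cstarNorm z :=
  norm_le_of_sq_le (cstarNorm_nonneg z)
    ((le_add_of_nonneg_left (IsOrderUnitAlgebra.sq_nonneg _)).trans (modulusSq_le z))

theorem cstarNorm_ofReal (x : B) : cstarNorm (ofReal x) = ‖x‖ :=
  le_antisymm (by simpa using cstarNorm_le_add (ofReal x))
    (by simpa using norm_re_le_cstarNorm (ofReal x))

/-- The identity `ab ((a + b)² - |z + w|²) = (ab + b²)(a² - |z|²) + (ab + a²)(b² - |w|²) + |bz -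
aw|²` replaces the Cauchy–Schwarz inequality. Strict bounds make `a * b` positive, so that it can be
cancelled. -/
theorem cstarNorm_add_le_of_lt {z w : Complexification B} {a b : ℝ} (ha : cstarNorm z < a)
    (hb : cstarNorm w < b) : cstarNorm (z + w) ≤ a + b := by
  have ha0 := (cstarNorm_nonneg z).trans_lt ha
  have hb0 := (cstarNorm_nonneg w).trans_lt hb
  rw [cstarNorm_le_iff (by positivity), ← sub_nonneg]
  have h1 := (cstarNorm_le_iff ha0.le).1 ha.le
  have h2 := (cstarNorm_le_iff hb0.le).1 hb.le
  refine nonneg_of_algebraMap_mul_nonneg (c := a * b) (by positivity) ?_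
  have h3 := mul_nonneg (algebraMap_nonneg (B := B) (by positivity : 0 ≤ a * b + b ^ 2))
    (sub_nonneg.2 h1)
  have h4 := mul_nonneg (algebraMap_nonneg (B := B) (by positivity : 0 ≤ a * b + a ^ 2))
    (sub_nonneg.2 h2)
  have h5 := modulusSq_nonneg
    (ofReal (algebraMap ℝ B b) * z - ofReal (algebraMap ℝ B a) * w)
  have := add_nonneg (add_nonneg h3 h4) h5
  convert this using 1
  simp only [modulusSq, map_mul, map_pow, map_add, add_re, add_im, sub_re, sub_im, mul_re, mul_im,
    ofReal_re, ofReal_im]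
  ring

variable (B) in
/-- The C⋆-norm on the complexification of an order unit algebra, as a ring norm. -/
noncomputable def cstarRingNorm : RingNorm (Complexification B) where
  toFun := cstarNorm
  map_zero' := by simp [cstarNorm, modulusSq]
  add_le' z w := by
    refine le_of_forall_pos_le_add fun ε hε => ?_
    have := cstarNorm_add_le_of_lt (lt_add_of_pos_right (cstarNorm z) (half_pos hε))
      (lt_add_of_pos_right (cstarNorm w) (half_pos hε))
    linarith
  neg' z := by simp [cstarNorm, modulusSq]
  mul_le' z w := by
    rw [cstarNorm, modulusSq_mul, cstarNorm, cstarNorm, ← Real.sqrt_mul (norm_nonneg _)]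
    exact Real.sqrt_le_sqrt (norm_mul_le _ _)
  eq_zero_of_map_eq_zero' z h := by
    ext
    · exact norm_le_zero_iff.1 (h ▸ norm_re_le_cstarNorm z)
    · exact norm_le_zero_iff.1 (h ▸ norm_im_le_cstarNorm z)

variable (B) in
/-- The complexification of a complete order unit algebra is a commutative C⋆-algebra. -/
noncomputable abbrev commCStarAlgebra [CompleteSpace B] : CommCStarAlgebra (Complexification B) :=
  letI : NormedRing (Complexification B) := (cstarRingNorm B).toNormedRing
  letI : NormedCommRing (Complexification B) :=
    { (cstarRingNorm B).toNormedRing with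
      mul_comm := fun z w => by
        ext <;> simp only [mul_re, mul_im] <;> ring }
  have norm_def : ∀ z : Complexification B, ‖z‖ = cstarNorm z := fun _ => rfl
  letI : StarRing (Complexification B) :=
    { star := fun z => ⟨z.re, -z.im⟩
      star_involutive := fun z => by ext <;> simp
      star_mul := fun z w => by ext <;> simp <;> ring
      star_add := fun z w => by ext <;> simp [add_comm] }
  have star_def : ∀ z : Complexification B, star z = ⟨z.re, -z.im⟩ := fun _ => rfl
  letI : NormedAlgebra ℂ (Complexification B) :=
    { (inferInstance : Algebra ℂ (Complexification B)) with
      norm_smul_le := fun c z => by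
        rw [norm_def, norm_def, cstarNorm, modulusSq_smul, norm_smul, cstarNorm,
          Real.sqrt_mul (norm_nonneg _)]
        simp }
  { (inferInstance : NormedCommRing (Complexification B)),
    (inferInstance : NormedAlgebra ℂ (Complexification B)),
    (inferInstance : StarRing (Complexification B)) with
    star_smul := fun c z => by ext <;> simp [star_def]; abel
    norm_mul_self_le := fun z => by
      have h : star z * z = ofReal (modulusSq z) := by
        ext <;> simp [star_def, modulusSq] <;> ring
      rw [h, norm_def, norm_def, cstarNorm_ofReal, cstarNorm, Real.mul_self_sqrt (norm_nonneg _)]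
    complete := by
      refine (Metric.complete_of_cauchySeq_tendsto fun u hu => ?_).complete
      have key : ∀ f : Complexification B → B, (∀ z w, f (z - w) = f z - f w) →
          (∀ z, ‖f z‖ ≤ cstarNorm z) → ∃ l, Filter.Tendsto (fun n => f (u n)) Filter.atTop
            (nhds l) := by
        intro f hsub hle
        refine cauchySeq_tendsto_of_complete (Metric.cauchySeq_iff.2 fun ε hε => ?_)
        obtain ⟨N, hN⟩ := Metric.cauchySeq_iff.1 hu ε hε
        refine ⟨N, fun m hm n hn => lt_of_le_of_lt ?_ (hN m hm n hn)⟩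
        rw [dist_eq_norm, dist_eq_norm, ← hsub]
        exact hle _
      obtain ⟨x, hx⟩ := key re (fun _ _ => rfl) norm_re_le_cstarNorm
      obtain ⟨y, hy⟩ := key im (fun _ _ => rfl) norm_im_le_cstarNorm
      refine ⟨⟨x, y⟩, tendsto_iff_norm_sub_tendsto_zero.2 ?_⟩
      have h := (tendsto_iff_norm_sub_tendsto_zero.1 hx).add
        (tendsto_iff_norm_sub_tendsto_zero.1 hy)
      rw [add_zero] at h
      exact squeeze_zero (fun _ => norm_nonneg _) (fun n => cstarNorm_le_add (u n - ⟨x, y⟩)) h }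

/-- Gelfand duality for the complexification of a complete order unit algebra. -/
theorem exists_algEquiv_continuousMap (B : Type u) [NormedCommRing B] [NormedAlgebra ℝ B]
    [PartialOrder B] [IsOrderUnitAlgebra B] [CompleteSpace B] :
    ∃ (K : Type u) (_ : TopologicalSpace K) (_ : CompactSpace K) (_ : T2Space K)
      (Φ : Complexification B ≃ₐ[ℂ] C(K, ℂ)),
      (∀ x t, (Φ (ofReal x) t).im = 0) ∧ (∀ x, ‖Φ (ofReal x)‖ = ‖x‖) ∧
      ∀ x, 0 ≤ x ↔ ∀ t, 0 ≤ (Φ (ofReal x) t).re := by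
  let := commCStarAlgebra B
  let Φ : Complexification B ≃⋆ₐ[ℂ] C(WeakDual.characterSpace ℂ (Complexification B), ℂ) :=
    gelfandStarTransform (Complexification B)
  have him : ∀ x t, (Φ (ofReal x) t).im = 0 := by
    intro x t
    have h : star (ofReal x) = ofReal x := by
      change (⟨_, _⟩ : Complexification B) = _
      ext <;> simp
    have h2 := congrArg (fun f => f t) (map_star Φ (ofReal x))
    rw [h] at h2
    exact Complex.conj_eq_iff_im.1 h2.symm
  have hnorm : ∀ x : B, ‖Φ (ofReal x)‖ = ‖x‖ := fun x => by
    rw [← cstarNorm_ofReal x]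
    exact (gelfandTransform_isometry _).norm_map_of_map_zero (map_zero _) _
  have hsub : ∀ x : B, ∀ t, Φ (ofReal (algebraMap ℝ B ‖x‖ - x)) t = ‖x‖ - Φ (ofReal x) t := by
    intro x t
    have : ofReal (algebraMap ℝ B ‖x‖ - x) = ofReal (algebraMap ℝ B ‖x‖) - ofReal x := by
      ext <;> simp
    rw [this, ofReal_algebraMap, map_sub, AlgHomClass.commutes]
    rfl
  refine ⟨_, inferInstance, inferInstance, inferInstance, Φ.toAlgEquiv, him, hnorm, fun x => ?_⟩
  change _ ↔ ∀ t, 0 ≤ (Φ (ofReal x) t).re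
  -- Positivity can be read off the norm: `0 ≤ x` exactly when `‖‖x‖ - x‖ ≤ ‖x‖`, both in `B` and
  -- for real functions on the character space. The isometry transfers this criterion.
  have hx := (norm_le_iff x ‖x‖ (norm_nonneg x)).1 le_rfl
  constructor
  · intro h t
    have h1 : ‖algebraMap ℝ B ‖x‖ - x‖ ≤ ‖x‖ := by
      rw [norm_le_iff_of_nonneg (sub_nonneg.2 hx.2) (norm_nonneg _)]
      exact sub_le_self _ h
    rw [← hnorm (_ - _)] at h1
    have h2 := ((Complex.re_le_norm _).trans (ContinuousMap.norm_coe_le_norm _ t)).trans h1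
    rw [hsub, Complex.sub_re, Complex.ofReal_re] at h2
    linarith
  · intro h
    have h1 : ‖algebraMap ℝ B ‖x‖ - x‖ ≤ ‖x‖ := by
      rw [← hnorm (_ - _), ContinuousMap.norm_le _ (norm_nonneg _)]
      intro t
      have h2 := (Complex.re_le_norm _).trans (ContinuousMap.norm_coe_le_norm (Φ (ofReal x)) t)
      rw [hnorm] at h2
      have h3 : Φ (ofReal (algebraMap ℝ B ‖x‖ - x)) t = ((‖x‖ - (Φ (ofReal x) t).re : ℝ) : ℂ) := by
        rw [hsub]
        apply Complex.ext <;> simp [him]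
      rw [h3, Complex.norm_real, Real.norm_of_nonneg (by linarith)]
      linarith [h t]
    have h4 := ((norm_le_iff _ _ (norm_nonneg x)).1 h1).2
    simpa using h4

end OrderUnit

end Complexification

/-! ### Product, norm and commutativity on the ideal generated by the identity -/

namespace IsBanachLattice

variable {X : Type*} [NormedAddCommGroup X] [NormedSpace ℝ X] [Lattice X] [IsBanachLattice X]

theorem abs_smul_le (c : ℝ) (x : X) : |c • x| ≤ |c| • |x| := by
  have key : ∀ (c : ℝ) (x : X), c • x ≤ |c| • |x| := by
    intro c x
    rcases le_total 0 c with hc | hc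
    · rw [abs_of_nonneg hc]
      exact smul_le_smul_of_nonneg_left (le_abs_self x) hc
    · rw [abs_of_nonpos hc, ← neg_smul_neg c x]
      exact smul_le_smul_of_nonneg_left (neg_le_abs x) (neg_nonneg.2 hc)
  refine abs_le'.2 ⟨key c x, ?_⟩
  rw [← smul_neg, ← abs_neg x]
  exact key c (-x)

end IsBanachLattice

namespace IsBanachLatticeAlgebra

section UnitIdeal

variable {A : Type*} [NormedRing A] [NormedAlgebra ℝ A] [Lattice A] [IsBanachLatticeAlgebra A]

/-- A Banach lattice is Archimedean: a positive element is zero if its multiples are dominated by a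
norm bounded sequence. -/
theorem eq_zero_of_forall_smul_le {q : A} (hq : 0 ≤ q) (v : ℕ → A) (C : ℝ)
    (hv : ∀ n, ‖v n‖ ≤ C) (h : ∀ n : ℕ, (n : ℝ) • q ≤ v n) : q = 0 := by
  by_contra hne
  have hpos : 0 < ‖q‖ := norm_pos_iff.2 hne
  obtain ⟨n, hn⟩ := exists_nat_gt (C / ‖q‖)
  rw [div_lt_iff₀ hpos] at hn
  have h0 : 0 ≤ (n : ℝ) • q := smul_nonneg n.cast_nonneg hq
  have : ‖(n : ℝ) • q‖ ≤ ‖v n‖ := by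
    refine HasSolidNorm.solid ?_
    rw [abs_of_nonneg h0, abs_of_nonneg (h0.trans (h n))]
    exact h n
  rw [norm_smul, Real.norm_natCast] at this
  linarith [hv n]

/-- An identity of norm one is positive. -/
theorem one_nonneg [NormOneClass A] : 0 ≤ (1 : A) := by
  set q : A := (1 : A)⁻ with hq
  have hq0 : 0 ≤ q := negPart_nonneg _
  have hu : |(1 : A)| = 1 + 2 • q := by
    rw [← posPart_add_negPart]
    nth_rewrite 3 [← posPart_sub_negPart (1 : A)]
    rw [← hq]; abel
  -- Since `|1| = 1 + 2q`, multiplying the `n`-th inequality by `|1|` produces an extra `-4n q²`,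
  -- which the positive term `h2` compensates.
  have hpow : ∀ n : ℕ, 0 ≤ |(1 : A)| ^ n - 1 - (2 * n : ℝ) • q := by
    intro n
    induction n with
    | zero => simp
    | succ n ih =>
      have h1 := IsBanachLatticeAlgebra.mul_nonneg _ _ ih (abs_nonneg (1 : A))
      have h2 : 0 ≤ (4 * n : ℝ) • (q * q) :=
        smul_nonneg (by positivity) (IsBanachLatticeAlgebra.mul_nonneg _ _ hq0 hq0)
      have h3 := add_nonneg h1 h2
      convert h3 using 1
      rw [pow_succ, sub_mul, sub_mul]
      generalize |(1 : A)| ^ n * |(1 : A)| = w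
      rw [hu]
      simp only [mul_add, mul_one, one_mul, smul_mul_assoc, mul_smul_comm]
      push_cast
      module
  have : q = 0 := by
    refine eq_zero_of_forall_smul_le hq0 (fun n => |(1 : A)| ^ n - 1) 2 (fun n => ?_) fun n => ?_
    · have h1 : ‖|(1 : A)| ^ n‖ ≤ 1 := by
        refine (norm_pow_le _ n).trans ?_
        simp [norm_abs_eq_norm]
      calc ‖|(1 : A)| ^ n - 1‖ ≤ ‖|(1 : A)| ^ n‖ + ‖(1 : A)‖ := norm_sub_le _ _
        _ ≤ 2 := by rw [norm_one]; linarith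
    · have h1 := add_nonneg (hpow n) (smul_nonneg (n.cast_nonneg (α := ℝ)) hq0)
      rw [← sub_nonneg]
      convert h1 using 1
      module
  exact negPart_eq_zero.1 this

instance [NormOneClass A] : IsOrderedRing A :=
  haveI : ZeroLEOneClass A := ⟨one_nonneg⟩
  IsOrderedRing.of_mul_nonneg IsBanachLatticeAlgebra.mul_nonneg

variable [NormOneClass A]

theorem smul_one_mono {c d : ℝ} (h : c ≤ d) : c • (1 : A) ≤ d • (1 : A) := by
  rw [← sub_nonneg, ← sub_smul]
  exact smul_nonneg (sub_nonneg.2 h) zero_le_one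

theorem abs_mul_le_mul_abs (x y : A) : |x * y| ≤ |x| * |y| := by
  have hx := posPart_nonneg x
  have hx' := negPart_nonneg x
  have hy := posPart_nonneg y
  have hy' := negPart_nonneg y
  rw [abs_le', ← posPart_add_negPart x, ← posPart_add_negPart y]
  nth_rewrite 1 [← posPart_sub_negPart x, ← posPart_sub_negPart y]
  nth_rewrite 5 [← posPart_sub_negPart x]
  nth_rewrite 5 [← posPart_sub_negPart y]
  generalize x⁺ = a at *
  generalize x⁻ = b at *
  generalize y⁺ = c at *
  generalize y⁻ = d at *
  -- With `x = a - b` and `y = c - d`, the two differences are `2(ad + bc)` and `2(ac + bd)`.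
  constructor <;> rw [← sub_nonneg]
  · have := add_nonneg (add_nonneg (mul_nonneg hx hy') (mul_nonneg hx' hy))
      (add_nonneg (mul_nonneg hx hy') (mul_nonneg hx' hy))
    convert this using 1
    noncomm_ring
  · have := add_nonneg (add_nonneg (mul_nonneg hx hy) (mul_nonneg hx' hy'))
      (add_nonneg (mul_nonneg hx hy) (mul_nonneg hx' hy'))
    convert this using 1
    noncomm_ring

variable (A) in
/-- The elements dominated by a multiple of the identity. -/
def unitIdeal : Subalgebra ℝ A where
  carrier := {x | ∃ c : ℝ, |x| ≤ c • (1 : A)}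
  add_mem' := by
    rintro x y ⟨c, hc⟩ ⟨d, hd⟩
    exact ⟨c + d, (abs_add_le x y).trans (by rw [add_smul]; exact add_le_add hc hd)⟩
  mul_mem' := by
    rintro x y ⟨c, hc⟩ ⟨d, hd⟩
    refine ⟨c * d, (abs_mul_le_mul_abs x y).trans ?_⟩
    have := mul_le_mul hc hd (abs_nonneg y) ((abs_nonneg x).trans hc)
    rwa [smul_mul_smul_comm, one_mul] at this
  algebraMap_mem' r := by
    refine ⟨|r|, ?_⟩
    rw [Algebra.algebraMap_eq_smul_one]
    refine (IsBanachLattice.abs_smul_le r 1).trans_eq ?_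
    rw [abs_of_nonneg zero_le_one]

theorem mem_unitIdeal {x : A} : x ∈ unitIdeal A ↔ ∃ c : ℝ, |x| ≤ c • (1 : A) := Iff.rfl

theorem mem_unitIdeal_of_abs_le {x y : A} (hx : x ∈ unitIdeal A) (h : |y| ≤ |x|) :
    y ∈ unitIdeal A := by
  obtain ⟨c, hc⟩ := hx
  exact ⟨c, h.trans hc⟩

theorem mem_unitIdeal_of_nonneg {x : A} (hx : 0 ≤ x) {c : ℝ} (h : x ≤ c • (1 : A)) :
    x ∈ unitIdeal A :=
  ⟨c, by rwa [abs_of_nonneg hx]⟩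

theorem exists_pos_abs_le {x : A} (hx : x ∈ unitIdeal A) : ∃ c : ℝ, 0 < c ∧ |x| ≤ c • (1 : A) := by
  obtain ⟨c, hc⟩ := hx
  exact ⟨max c 1, by positivity, hc.trans (smul_one_mono (le_max_left _ _))⟩

/-- From `a ≤ c • 1` and `b ≤ d • 1` follow `a * b ≤ c • b` and `a * b ≤ d • a`, so `(c + d)⁻¹ • (a
* b)` lies below `a ⊓ b`. -/
theorem mul_eq_zero_of_inf_eq_zero {a b : A} (ha : 0 ≤ a) (hb : 0 ≤ b) (ha' : a ∈ unitIdeal A)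
    (hb' : b ∈ unitIdeal A) (h : a ⊓ b = 0) : a * b = 0 := by
  obtain ⟨c, hc0, hc⟩ := exists_pos_abs_le ha'
  obtain ⟨d, hd0, hd⟩ := exists_pos_abs_le hb'
  rw [abs_of_nonneg ha] at hc
  rw [abs_of_nonneg hb] at hd
  have h1 : a * b ≤ c • b := by
    simpa using mul_le_mul_of_nonneg_right hc hb
  have h2 : a * b ≤ d • a := by
    simpa using mul_le_mul_of_nonneg_left hd ha
  have h0 : 0 ≤ a * b := mul_nonneg ha hb
  have hm : 0 ≤ (c + d)⁻¹ := by positivity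
  have hcd : (c + d)⁻¹ * (c + d) = 1 := inv_mul_cancel₀ (by positivity)
  have h3 : (c + d)⁻¹ • (a * b) ≤ a ⊓ b := by
    refine le_inf ?_ ?_
    · have := smul_le_smul_of_nonneg_left (h2.trans
        (le_add_of_nonneg_left (smul_nonneg hc0.le ha))) hm
      rwa [← add_smul, smul_smul, hcd, one_smul] at this
    · have := smul_le_smul_of_nonneg_left (h1.trans
        (le_add_of_nonneg_right (smul_nonneg hd0.le hb))) hm
      rwa [← add_smul, smul_smul, hcd, one_smul] at this
  rw [h] at h3
  have h4 := le_antisymm h3 (smul_nonneg hm h0)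
  exact (smul_eq_zero.1 h4).resolve_left (by positivity)

theorem posPart_mem_unitIdeal {x : A} (hx : x ∈ unitIdeal A) : x⁺ ∈ unitIdeal A := by
  refine mem_unitIdeal_of_abs_le hx ?_
  rw [abs_of_nonneg (posPart_nonneg x), ← posPart_add_negPart]
  exact le_add_of_nonneg_right (negPart_nonneg x)

theorem negPart_mem_unitIdeal {x : A} (hx : x ∈ unitIdeal A) : x⁻ ∈ unitIdeal A := by
  refine mem_unitIdeal_of_abs_le hx ?_
  rw [abs_of_nonneg (negPart_nonneg x), ← posPart_add_negPart]
  exact le_add_of_nonneg_left (posPart_nonneg x)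

theorem posPart_mul_negPart {x : A} (hx : x ∈ unitIdeal A) : x⁺ * x⁻ = 0 :=
  mul_eq_zero_of_inf_eq_zero (posPart_nonneg x) (negPart_nonneg x) (posPart_mem_unitIdeal hx)
    (negPart_mem_unitIdeal hx) (posPart_inf_negPart_eq_zero x)

theorem negPart_mul_posPart {x : A} (hx : x ∈ unitIdeal A) : x⁻ * x⁺ = 0 :=
  mul_eq_zero_of_inf_eq_zero (negPart_nonneg x) (posPart_nonneg x) (negPart_mem_unitIdeal hx)
    (posPart_mem_unitIdeal hx) (by rw [inf_comm, posPart_inf_negPart_eq_zero x])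

/-- The cross terms `x⁺ * x⁻` and `x⁻ * x⁺` vanish by disjointness. This is the source of the
positivity of squares. -/
theorem abs_mul_abs_of_mem_unitIdeal {x : A} (hx : x ∈ unitIdeal A) : |x| * |x| = x * x := by
  rw [← posPart_add_negPart]
  conv_rhs => rw [← posPart_sub_negPart x]
  simp only [mul_add, add_mul, mul_sub, sub_mul, posPart_mul_negPart hx, negPart_mul_posPart hx]
  abel

theorem mul_self_nonneg_of_mem_unitIdeal {x : A} (hx : x ∈ unitIdeal A) : 0 ≤ x * x := by
  rw [← abs_mul_abs_of_mem_unitIdeal hx]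
  exact mul_nonneg (abs_nonneg x) (abs_nonneg x)

/-- Bernoulli's inequality. -/
theorem smul_sub_one_le_pow {x : A} (hx : x ∈ unitIdeal A) (h0 : 0 ≤ x) (n : ℕ) :
    1 + (n : ℝ) • (x - 1) ≤ x ^ n := by
  induction n with
  | zero => simp
  | succ n ih =>
    have h1 := mul_nonneg (sub_nonneg.2 ih) h0
    -- The gap at `n + 1` is the gap at `n` times `x`, plus `n (x - 1)²`.
    have h2 : 0 ≤ (n : ℝ) • ((x - 1) * (x - 1)) :=
      smul_nonneg n.cast_nonneg (mul_self_nonneg_of_mem_unitIdeal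
        ((unitIdeal A).sub_mem hx (one_mem _)))
    rw [← sub_nonneg]
    have := add_nonneg h1 h2
    convert this using 1
    rw [pow_succ]
    simp only [sub_mul, add_mul, mul_sub, smul_mul_assoc, one_mul, mul_one, smul_sub]
    push_cast
    module

/-- Bernoulli gives `n (x - 1)⁺ ≤ x ^ n` for `n > 0`, and the powers stay in the unit ball, so `(x -
1)⁺ = 0` by the Archimedean property. -/
theorem le_one_of_norm_le_one {x : A} (hx : x ∈ unitIdeal A) (h0 : 0 ≤ x) (h : ‖x‖ ≤ 1) :
    x ≤ 1 := by
  have : (x - 1)⁺ = 0 := by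
    refine eq_zero_of_forall_smul_le (posPart_nonneg _) (fun n => x ^ n) 1 (fun n => ?_) fun n => ?_
    · exact (norm_pow_le x n).trans (pow_le_one₀ (norm_nonneg x) h)
    · rcases Nat.eq_zero_or_pos n with rfl | hn
      · simp
      have hn' : (0 : ℝ) < n := by exact_mod_cast hn
      have h1 : (n : ℝ)⁻¹ • x ^ n ≥ (x - 1)⁺ := by
        refine sup_le ?_ (smul_nonneg (by positivity) (pow_nonneg h0 n))
        have := smul_le_smul_of_nonneg_left ((le_add_of_nonneg_left zero_le_one).trans
          (smul_sub_one_le_pow hx h0 n)) (inv_nonneg.2 hn'.le)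
        rwa [smul_smul, inv_mul_cancel₀ hn'.ne', one_smul] at this
      have := smul_le_smul_of_nonneg_left h1 hn'.le
      rwa [smul_smul, mul_inv_cancel₀ hn'.ne', one_smul] at this
  exact sub_nonpos.1 (posPart_eq_zero.1 this)

/-- On the ideal generated by the identity, the order unit norm is at most the norm. -/
theorem abs_le_norm_smul_one {x : A} (hx : x ∈ unitIdeal A) : |x| ≤ ‖x‖ • (1 : A) := by
  rcases eq_or_ne x 0 with rfl | hne
  · simp
  have hpos : 0 < ‖x‖ := norm_pos_iff.2 hne
  have h0 : 0 ≤ ‖x‖⁻¹ • |x| := smul_nonneg (by positivity) (abs_nonneg x)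
  have hmem : ‖x‖⁻¹ • |x| ∈ unitIdeal A :=
    (unitIdeal A).smul_mem (mem_unitIdeal_of_abs_le hx (abs_abs x).le) _
  have h1 := le_one_of_norm_le_one hmem h0 (by
    rw [norm_smul, norm_abs_eq_norm, norm_inv, norm_norm, inv_mul_cancel₀ hpos.ne'])
  have := smul_le_smul_of_nonneg_left h1 hpos.le
  rwa [smul_smul, mul_inv_cancel₀ hpos.ne', one_smul] at this

theorem norm_le_of_abs_le_smul_one {x : A} {c : ℝ} (h : |x| ≤ c • (1 : A)) (hc : 0 ≤ c) :
    ‖x‖ ≤ c := by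
  have : ‖x‖ ≤ ‖c • (1 : A)‖ := by
    refine HasSolidNorm.solid ?_
    rwa [abs_of_nonneg (smul_nonneg hc zero_le_one : 0 ≤ c • (1 : A))]
  rwa [norm_smul, norm_one, mul_one, Real.norm_of_nonneg hc] at this

/-- When `x² = 0`, the positive square `(n|x| - 1)²` equals `1 - 2n|x|`, so every multiple of `|x|`
stays below the identity. -/
theorem eq_zero_of_mul_self_eq_zero {x : A} (hx : x ∈ unitIdeal A) (h : x * x = 0) : x = 0 := by
  have habs : |x| ∈ unitIdeal A := mem_unitIdeal_of_abs_le hx (abs_abs x).le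
  have : |x| = 0 := by
    refine eq_zero_of_forall_smul_le (abs_nonneg x) (fun _ => 1) 1 (fun _ => norm_one.le)
      fun n => ?_
    have h1 := mul_self_nonneg_of_mem_unitIdeal
      ((unitIdeal A).sub_mem ((unitIdeal A).smul_mem habs (n : ℝ)) (one_mem _))
    have h2 : ((n : ℝ) • |x| - 1) * ((n : ℝ) • |x| - 1) = 1 - (2 * n : ℝ) • |x| := by
      simp only [sub_mul, mul_sub, smul_mul_assoc, mul_smul_comm,
        abs_mul_abs_of_mem_unitIdeal hx, h]
      simp only [one_mul, mul_one, smul_zero]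
      module
    rw [h2] at h1
    have h3 := add_nonneg h1 (smul_nonneg (n.cast_nonneg (α := ℝ)) (abs_nonneg x))
    rw [← sub_nonneg]
    convert h3 using 1
    module
  exact norm_eq_zero.1 (by rw [← norm_abs_eq_norm, this, norm_zero])

-- The commutator `c` of `x` and `y` does not change when `x` is replaced by `x - a`, so `c²` is at
-- most `4C² (x - a)²` for all real `a`. Averaging over `a = ν / n` with the Bernstein weights
-- evaluated at `x` turns the right side into `4C² x (1 - x) / n`. Hence `c² = 0`, and the ideal has
-- no nonzero element of square zero.
open Polynomial in
theorem commute_of_nonneg_of_le_one {x y : A} (h0 : 0 ≤ x) (h1 : x ≤ 1) (hy : y ∈ unitIdeal A) :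
    x * y = y * x := by
  obtain ⟨C, hC0, hC⟩ := exists_pos_abs_le hy
  have hx : x ∈ unitIdeal A := mem_unitIdeal_of_nonneg h0 (c := 1) (by rwa [one_smul])
  set c := x * y - y * x with hc
  have hcm : c ∈ unitIdeal A :=
    (unitIdeal A).sub_mem ((unitIdeal A).mul_mem hx hy) ((unitIdeal A).mul_mem hy hx)
  have habs : ∀ a : ℝ, |c| ≤ (2 * C) • |x - a • 1| := by
    intro a
    have h : c = (x - a • 1) * y - y * (x - a • 1) := by
      rw [hc]
      simp only [sub_mul, mul_sub, smul_mul_assoc, mul_smul_comm, one_mul, mul_one]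
      abel
    have e1 : |(x - a • 1) * y| ≤ C • |x - a • 1| := by
      refine (abs_mul_le_mul_abs _ _).trans ?_
      simpa using mul_le_mul_of_nonneg_left hC (abs_nonneg (x - a • 1))
    have e2 : |y * (x - a • 1)| ≤ C • |x - a • 1| := by
      refine (abs_mul_le_mul_abs _ _).trans ?_
      simpa using mul_le_mul_of_nonneg_right hC (abs_nonneg (x - a • 1))
    rw [h, sub_eq_add_neg]
    refine (abs_add_le _ _).trans ?_
    rw [abs_neg, two_mul, add_smul]
    exact add_le_add e1 e2
  have hsq : ∀ a : ℝ, c * c ≤ (4 * C ^ 2) • ((x - a • 1) * (x - a • 1)) := by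
    intro a
    have hm : x - a • 1 ∈ unitIdeal A :=
      (unitIdeal A).sub_mem hx ((unitIdeal A).smul_mem (one_mem _) a)
    have := mul_le_mul (habs a) (habs a) (abs_nonneg c)
      ((abs_nonneg c).trans (habs a))
    rw [abs_mul_abs_of_mem_unitIdeal hcm, smul_mul_smul_comm,
      abs_mul_abs_of_mem_unitIdeal hm] at this
    convert this using 2
    ring
  have hb : ∀ n ν : ℕ, 0 ≤ aeval x (bernsteinPolynomial ℝ n ν) := by
    intro n ν
    simp only [bernsteinPolynomial, map_mul, map_pow, map_sub, aeval_X, map_one, map_natCast]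
    exact mul_nonneg (mul_nonneg (Nat.cast_nonneg _) (pow_nonneg h0 _))
      (pow_nonneg (sub_nonneg.2 h1) _)
  have hzero : c * c = 0 := by
    refine eq_zero_of_forall_smul_le (mul_self_nonneg_of_mem_unitIdeal hcm)
      (fun _ => (4 * C ^ 2) • (1 : A)) ‖(4 * C ^ 2) • (1 : A)‖ (fun _ => le_rfl) fun n => ?_
    rcases Nat.eq_zero_or_pos n with rfl | hn
    · simpa using smul_nonneg (by positivity : 0 ≤ 4 * C ^ 2) (zero_le_one (α := A))
    have hn' : (0 : ℝ) < n := by exact_mod_cast hn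
    -- The bound `hsq` at `a = ν / n`, multiplied by a positive Bernstein weight; the factor `n²`
    -- clears the denominator of `a`.
    have hν : ∀ ν : ℕ, ((n : ℝ) ^ 2) • (c * c) * aeval x (bernsteinPolynomial ℝ n ν) ≤
        (4 * C ^ 2) • aeval x ((n • X - (ν : ℝ[X])) ^ 2 * bernsteinPolynomial ℝ n ν) := by
      intro ν
      have e := mul_le_mul_of_nonneg_right
        (smul_le_smul_of_nonneg_left (hsq (ν / n)) (sq_nonneg (n : ℝ))) (hb n ν)
      refine e.trans_eq ?_
      have e2 : aeval x (n • X - (ν : ℝ[X])) = (n : ℝ) • (x - ((ν : ℝ) / n) • (1 : A)) := by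
        simp only [map_sub, map_nsmul, aeval_X, map_natCast, smul_sub, smul_smul]
        rw [mul_div_cancel₀ _ hn'.ne', Nat.cast_smul_eq_nsmul, Nat.cast_smul_eq_nsmul,
          nsmul_one]
      rw [smul_comm, smul_mul_assoc, map_mul, map_pow, e2, _root_.smul_pow, sq (x - _)]
    -- The weights sum to `1` and their variance is `n x (1 - x)`, leaving `n² c² ≤ 4C² n x (1 -
    -- x)`.
    have hsum := Finset.sum_le_sum fun ν (_ : ν ∈ Finset.range (n + 1)) => hν ν
    rw [← Finset.mul_sum, ← Finset.smul_sum, ← map_sum, ← map_sum, bernsteinPolynomial.sum,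
      bernsteinPolynomial.variance, map_one, mul_one] at hsum
    have e3 : aeval x (n • X * ((1 : ℝ[X]) - X)) ≤ (n : ℝ) • (1 : A) := by
      simp only [map_mul, map_sub, map_nsmul, aeval_X, map_one]
      rw [← Nat.cast_smul_eq_nsmul ℝ, smul_mul_assoc]
      refine smul_le_smul_of_nonneg_left ?_ hn'.le
      have := mul_le_mul h1 (sub_le_self 1 h0) (sub_nonneg.2 h1) zero_le_one
      rwa [one_mul] at this
    have e4 := smul_le_smul_of_nonneg_left
      (hsum.trans (smul_le_smul_of_nonneg_left e3 (by positivity))) (inv_nonneg.2 hn'.le)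
    convert e4 using 1
    · rw [smul_smul, sq, inv_mul_cancel_left₀ hn'.ne']
    · rw [smul_smul, smul_smul]
      congr 1
      field_simp
  exact sub_eq_zero.1 (eq_zero_of_mul_self_eq_zero hcm hzero)

theorem commute_of_nonneg {x y : A} (h0 : 0 ≤ x) (hx : x ∈ unitIdeal A) (hy : y ∈ unitIdeal A) :
    x * y = y * x := by
  obtain ⟨c, hc0, hc⟩ := exists_pos_abs_le hx
  rw [abs_of_nonneg h0] at hc
  have h1 : c⁻¹ • x ≤ 1 := by
    have := smul_le_smul_of_nonneg_left hc (inv_nonneg.2 hc0.le)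
    rwa [smul_smul, inv_mul_cancel₀ hc0.ne', one_smul] at this
  have := congrArg (c • ·)
    (commute_of_nonneg_of_le_one (smul_nonneg (inv_nonneg.2 hc0.le) h0) h1 hy)
  simpa [smul_mul_assoc, mul_smul_comm, smul_smul, hc0.ne'] using this

/-- The ideal generated by the identity is commutative. -/
theorem commute_of_mem_unitIdeal {x y : A} (hx : x ∈ unitIdeal A) (hy : y ∈ unitIdeal A) :
    x * y = y * x := by
  rw [← posPart_sub_negPart x, sub_mul, mul_sub,
    commute_of_nonneg (posPart_nonneg x) (posPart_mem_unitIdeal hx) hy,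
    commute_of_nonneg (negPart_nonneg x) (negPart_mem_unitIdeal hx) hy]

end UnitIdeal

end IsBanachLatticeAlgebra

/-! ### The projection onto the ideal generated by the identity -/

namespace IsBanachLatticeAlgebra

section ProjectionBand

variable {A : Type*} [NormedRing A] [NormedAlgebra ℝ A] [Lattice A] [IsBanachLatticeAlgebra A]
  [NormOneClass A]

theorem isIdeal_unitIdeal : RealLattice.IsIdeal (Subalgebra.toSubmodule (unitIdeal A)) :=
  fun _ hx _ h => mem_unitIdeal_of_abs_le hx h

theorem idealGen_one_eq_unitIdeal :
    RealLattice.idealGen (1 : A) = Subalgebra.toSubmodule (unitIdeal A) := by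
  refine le_antisymm (sInf_le ⟨isIdeal_unitIdeal, one_mem (unitIdeal A)⟩) (le_sInf ?_)
  rintro B ⟨hB, h1⟩ x hx
  obtain ⟨c, hc0, hc⟩ := exists_pos_abs_le (A := A) hx
  refine hB (B.smul_mem c h1) ?_
  rwa [abs_of_nonneg (smul_nonneg hc0.le zero_le_one : 0 ≤ c • (1 : A))]

theorem mem_disjointCompl_unitIdeal {x : A} :
    x ∈ RealLattice.disjointCompl (Subalgebra.toSubmodule (unitIdeal A)) ↔ |x| ⊓ 1 = 0 := by
  constructor
  · intro h
    have := h 1 (one_mem (unitIdeal A))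
    rwa [abs_of_nonneg (zero_le_one (α := A))] at this
  · intro h y hy
    obtain ⟨c, hc⟩ := mem_unitIdeal.1 (show y ∈ unitIdeal A from hy)
    -- Taking `d ≥ 1` ensures `d⁻¹ ≤ 1`, so scaling `|x| ⊓ |y|` by `d⁻¹` keeps it below `|x|` while
    -- bringing it below `1`.
    set d := max c 1
    have hd1 : 1 ≤ d := le_max_right _ _
    have hd0 : 0 < d := by positivity
    replace hc : |y| ≤ d • (1 : A) := hc.trans (smul_one_mono (le_max_left _ _))
    have h0 : 0 ≤ |x| ⊓ |y| := le_inf (abs_nonneg x) (abs_nonneg y)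
    have h1 : d⁻¹ • (|x| ⊓ |y|) ≤ |x| ⊓ 1 := by
      refine le_inf ?_ ?_
      · have : 0 ≤ (1 - d⁻¹) • (|x| ⊓ |y|) :=
          smul_nonneg (sub_nonneg.2 (inv_le_one_of_one_le₀ hd1)) h0
        rw [sub_smul, one_smul, sub_nonneg] at this
        exact this.trans inf_le_left
      · have := smul_le_smul_of_nonneg_left (inf_le_right.trans hc : |x| ⊓ |y| ≤ _)
          (inv_nonneg.2 hd0.le)
        rwa [smul_smul, inv_mul_cancel₀ hd0.ne', one_smul] at this
    rw [h] at h1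
    have h2 := le_antisymm h1 (smul_nonneg (inv_nonneg.2 hd0.le) h0)
    exact (smul_eq_zero.1 h2).resolve_left (by positivity)

theorem sub_mem_disjointCompl_unitIdeal {x y : A}
    (hx : x ∈ RealLattice.disjointCompl (Subalgebra.toSubmodule (unitIdeal A)))
    (hy : y ∈ RealLattice.disjointCompl (Subalgebra.toSubmodule (unitIdeal A))) :
    x - y ∈ RealLattice.disjointCompl (Subalgebra.toSubmodule (unitIdeal A)) := by
  rw [mem_disjointCompl_unitIdeal] at *
  refine le_antisymm ?_ (le_inf (abs_nonneg _) zero_le_one)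
  have h1 : |x - y| ≤ |x| + |y| := by
    rw [sub_eq_add_neg, ← abs_neg y]
    exact abs_add_le x (-y)
  have h2 : (|x| + |y|) ⊓ 1 ≤ |x| ⊓ 1 + |y| ⊓ 1 := by
    rw [add_inf, inf_add, inf_add]
    refine le_inf (le_inf inf_le_left ?_) (le_inf ?_ ?_)
    · exact inf_le_right.trans (le_add_of_nonneg_right (abs_nonneg y))
    · exact inf_le_right.trans (le_add_of_nonneg_left (abs_nonneg x))
    · exact inf_le_right.trans (le_add_of_nonneg_right zero_le_one)
  rw [hx, hy, add_zero] at h2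
  exact (inf_le_inf_right 1 h1).trans h2

theorem eq_of_add_eq_add {p q p' q' : A} (hp : p ∈ unitIdeal A) (hp' : p' ∈ unitIdeal A)
    (hq : q ∈ RealLattice.disjointCompl (Subalgebra.toSubmodule (unitIdeal A)))
    (hq' : q' ∈ RealLattice.disjointCompl (Subalgebra.toSubmodule (unitIdeal A)))
    (h : p + q = p' + q') : p = p' ∧ q = q' := by
  have h1 : p - p' = q' - q := by
    rw [sub_eq_sub_iff_add_eq_add, h, add_comm]
  have h2 := sub_mem_disjointCompl_unitIdeal hq' hq (p - p') ((unitIdeal A).sub_mem hp hp')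
  rw [← h1, inf_idem] at h2
  have h3 : p - p' = 0 := norm_eq_zero.1 (by rw [← norm_abs_eq_norm, h2, norm_zero])
  exact ⟨sub_eq_zero.1 h3, (sub_eq_zero.1 (h1 ▸ h3)).symm⟩

/-- The component of a positive element `x` in the ideal generated by the identity is
`x ⊓ ‖x‖ • 1`. -/
theorem exists_add_eq_of_nonneg {x : A} (hx : 0 ≤ x) : ∃ p q : A, 0 ≤ p ∧ 0 ≤ q ∧
    p ∈ unitIdeal A ∧ q ∈ RealLattice.disjointCompl (Subalgebra.toSubmodule (unitIdeal A)) ∧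
    p + q = x := by
  have h1 : 0 ≤ ‖x‖ • (1 : A) := smul_nonneg (norm_nonneg x) zero_le_one
  have hp : 0 ≤ x ⊓ ‖x‖ • (1 : A) := le_inf hx h1
  have hq : 0 ≤ x - x ⊓ ‖x‖ • (1 : A) := sub_nonneg.2 inf_le_left
  refine ⟨_, _, hp, hq, mem_unitIdeal_of_nonneg hp inf_le_right, ?_, add_sub_cancel _ x⟩
  rw [mem_disjointCompl_unitIdeal, abs_of_nonneg hq]
  refine le_antisymm ?_ (le_inf hq zero_le_one)
  -- Write `p = x ⊓ ‖x‖ • 1`. Adding `p` turns the claim `(x - p) ⊓ 1 ≤ 0` into `r ≤ p` for `r = x ⊓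
  -- (1 + p)`. This `r` lies in the ideal and `0 ≤ r ≤ x`, so `r ≤ ‖r‖ • 1 ≤ ‖x‖ • 1`.
  rw [← add_le_iff_nonpos_left (b := x ⊓ ‖x‖ • (1 : A)), inf_add, sub_add_cancel]
  refine le_inf inf_le_left ?_
  have hr : x ⊓ (1 + x ⊓ ‖x‖ • (1 : A)) ≤ (1 + ‖x‖) • (1 : A) := by
    refine inf_le_right.trans ?_
    rw [add_smul, one_smul]
    gcongr
    exact inf_le_right
  have hr0 : 0 ≤ x ⊓ (1 + x ⊓ ‖x‖ • (1 : A)) := le_inf hx (add_nonneg zero_le_one hp)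
  have h2 := abs_le_norm_smul_one (mem_unitIdeal_of_nonneg hr0 hr)
  rw [abs_of_nonneg hr0] at h2
  refine h2.trans (smul_one_mono (HasSolidNorm.solid ?_))
  rw [abs_of_nonneg hr0, abs_of_nonneg hx]
  exact inf_le_left

theorem exists_add_eq (x : A) : ∃ p q : A, p ∈ unitIdeal A ∧
    q ∈ RealLattice.disjointCompl (Subalgebra.toSubmodule (unitIdeal A)) ∧ p + q = x := by
  obtain ⟨p, q, -, -, hp, hq, h⟩ := exists_add_eq_of_nonneg (posPart_nonneg x)
  obtain ⟨p', q', -, -, hp', hq', h'⟩ := exists_add_eq_of_nonneg (negPart_nonneg x)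
  refine ⟨p - p', q - q', (unitIdeal A).sub_mem hp hp', sub_mem_disjointCompl_unitIdeal hq hq', ?_⟩
  rw [← posPart_sub_negPart x, ← h, ← h']
  abel

/-- For the band property, split the supremum as `s = p + q`. For `d ∈ D`, the positive element `s -
d` has positive components, which by uniqueness are `p - d` and `q`. So `p` is an upper bound of `D`
with `p ≤ s`, whence `s = p`. -/
theorem isProjectionBand_unitIdeal :
    RealLattice.IsProjectionBand (Subalgebra.toSubmodule (unitIdeal A)) := by
  refine ⟨⟨isIdeal_unitIdeal, fun D hD hne _ s hs => ?_⟩, fun x => ?_⟩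
  · obtain ⟨p, q, hp, hq, h⟩ := exists_add_eq s
    have key : ∀ d ∈ D, d ≤ p ∧ 0 ≤ q := by
      intro d hd
      obtain ⟨p', q', hp0, hq0, hp', hq', h'⟩ := exists_add_eq_of_nonneg (sub_nonneg.2 (hs.1 hd))
      obtain ⟨h1, h2⟩ := eq_of_add_eq_add hp' ((unitIdeal A).sub_mem hp (hD hd)) hq' hq
        (by rw [h', ← h]; abel)
      exact ⟨sub_nonneg.1 (h1 ▸ hp0), h2 ▸ hq0⟩
    obtain ⟨d, hd⟩ := hne
    have hsp : s ≤ p := hs.2 fun d hd => (key d hd).1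
    have hps : p ≤ s := h ▸ le_add_of_nonneg_right (key d hd).2
    exact le_antisymm hsp hps ▸ hp
  · obtain ⟨p, q, hp, hq, h⟩ := exists_add_eq x
    refine ⟨(p, q), ⟨hp, hq, h⟩, ?_⟩
    rintro ⟨p', q'⟩ ⟨hp', hq', h'⟩
    obtain ⟨h1, h2⟩ := eq_of_add_eq_add hp' hp hq' hq (h'.trans h.symm)
    exact Prod.ext h1 h2

end ProjectionBand

/-! ### The ideal as a complete order unit algebra -/

section OrderUnitAlgebra

variable {A : Type*} [NormedRing A] [NormedAlgebra ℝ A] [Lattice A] [IsBanachLatticeAlgebra A]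
  [NormOneClass A]

noncomputable instance : NormedCommRing (unitIdeal A) :=
  { (inferInstance : NormedRing (unitIdeal A)) with
    mul_comm := fun x y => Subtype.ext (commute_of_mem_unitIdeal x.2 y.2) }

instance : IsOrderUnitAlgebra (unitIdeal A) where
  __ := (inferInstance : IsOrderedRing (unitIdeal A))
  sq_nonneg x := by
    have := mul_self_nonneg_of_mem_unitIdeal x.2
    rw [← Subtype.coe_le_coe, sq]
    exact this
  norm_le_iff x c hc := by
    have hcoe : ((algebraMap ℝ (unitIdeal A) c : unitIdeal A) : A) = c • (1 : A) :=
      Algebra.algebraMap_eq_smul_one c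
    rw [← Subtype.coe_le_coe, ← Subtype.coe_le_coe, NegMemClass.coe_neg, hcoe]
    constructor
    · intro h
      have h1 := abs_le'.1 ((abs_le_norm_smul_one x.2).trans (smul_one_mono h))
      exact ⟨neg_le.1 h1.2, h1.1⟩
    · rintro ⟨h1, h2⟩
      exact norm_le_of_abs_le_smul_one (x := (x : A)) (abs_le'.2 ⟨h2, neg_le.1 h1⟩) hc

/-- The ideal is closed, being cut out by the closed condition `|x| ≤ ‖x‖ • 1`, in which the
constant no longer depends on a choice. -/
instance : CompleteSpace (unitIdeal A) := by
  have h : (unitIdeal A : Set A) = {x : A | x ⊔ -x ≤ ‖x‖ • (1 : A)} :=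
    Set.ext fun x => ⟨fun hx => abs_le_norm_smul_one hx, fun hx => ⟨_, hx⟩⟩
  have hc : IsClosed (unitIdeal A : Set A) := by
    rw [h]
    exact isClosed_le (by fun_prop) (by fun_prop)
  exact hc.completeSpace_coe

end OrderUnitAlgebra

end IsBanachLatticeAlgebra

/-! ### Modulus and norm on the complexification -/

namespace Complexification

section Modulus

variable {X : Type*} [NormedAddCommGroup X] [NormedSpace ℝ X] [Lattice X] [IsBanachLattice X]

/-- Periodicity removes the restriction of the angle to `[0, 2π]`. -/
theorem rotation_le_modulus (z : Complexification X) (φ : ℝ) :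
    Real.cos φ • z.re + Real.sin φ • z.im ≤ modulus z := by
  refine (isLUB_modulus z).1 ⟨toIcoMod Real.two_pi_pos 0 φ, ?_, ?_⟩
  · have := toIcoMod_mem_Ico Real.two_pi_pos 0 φ
    rw [zero_add] at this
    exact Set.Ico_subset_Icc_self this
  · simp only [← self_sub_toIcoDiv_zsmul, zsmul_eq_mul, Real.cos_sub_int_mul_two_pi,
      Real.sin_sub_int_mul_two_pi]

theorem modulus_le {z : Complexification X} {b : X}
    (h : ∀ φ : ℝ, Real.cos φ • z.re + Real.sin φ • z.im ≤ b) : modulus z ≤ b := by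
  refine (isLUB_modulus z).2 ?_
  rintro _ ⟨φ, -, rfl⟩
  exact h φ

theorem abs_re_le_modulus (z : Complexification X) : |z.re| ≤ modulus z :=
  abs_le'.2 ⟨by simpa using rotation_le_modulus z 0, by simpa using rotation_le_modulus z Real.pi⟩

theorem abs_im_le_modulus (z : Complexification X) : |z.im| ≤ modulus z :=
  abs_le'.2 ⟨by simpa using rotation_le_modulus z (Real.pi / 2),
    by simpa using rotation_le_modulus z (-(Real.pi / 2))⟩

theorem modulus_nonneg (z : Complexification X) : 0 ≤ modulus z :=
  (abs_nonneg _).trans (abs_re_le_modulus z)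

theorem modulus_le_add (z : Complexification X) : modulus z ≤ |z.re| + |z.im| := by
  have key : ∀ (c : ℝ) (x : X), |c| ≤ 1 → c • x ≤ |x| := by
    intro c x hc
    refine (le_abs_self _).trans ((IsBanachLattice.abs_smul_le c x).trans ?_)
    have : 0 ≤ (1 - |c|) • |x| := smul_nonneg (sub_nonneg.2 hc) (abs_nonneg x)
    rwa [sub_smul, one_smul, sub_nonneg] at this
  exact modulus_le fun φ => add_le_add (key _ _ (Real.abs_cos_le_one φ))
    (key _ _ (Real.abs_sin_le_one φ))

theorem modulus_ofReal_of_nonneg {x : X} (hx : 0 ≤ x) : modulus (ofReal x) = x := by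
  refine le_antisymm ?_ ?_
  · simpa [abs_of_nonneg hx] using modulus_le_add (ofReal x)
  · simpa [abs_of_nonneg hx] using abs_re_le_modulus (ofReal x)

theorem norm_re_le (z : Complexification X) : ‖z.re‖ ≤ ‖z‖ := by
  refine HasSolidNorm.solid ?_
  rw [abs_of_nonneg (modulus_nonneg z)]
  exact abs_re_le_modulus z

theorem norm_im_le (z : Complexification X) : ‖z.im‖ ≤ ‖z‖ := by
  refine HasSolidNorm.solid ?_
  rw [abs_of_nonneg (modulus_nonneg z)]
  exact abs_im_le_modulus z

theorem norm_le_add (z : Complexification X) : ‖z‖ ≤ ‖z.re‖ + ‖z.im‖ := by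
  rw [← norm_abs_eq_norm z.re, ← norm_abs_eq_norm z.im]
  refine le_trans (HasSolidNorm.solid ?_) (norm_add_le _ _)
  rw [abs_of_nonneg (modulus_nonneg z),
    abs_of_nonneg (add_nonneg (abs_nonneg z.re) (abs_nonneg z.im))]
  exact modulus_le_add z

end Modulus

theorem interReal_ofSubmodule {X : Type*} [AddCommGroup X] [Module ℝ X] (B : Submodule ℝ X) :
    interReal (ofSubmodule B) = B :=
  Submodule.ext fun _ => ⟨fun h => h.1, fun h => ⟨h, B.zero_mem⟩⟩

section Subalgebra

variable {A : Type*} [Ring A] [Algebra ℝ A]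

/-- The complexification of a real subalgebra, as a subalgebra of the complexification. -/
def ofSubalgebra (U : Subalgebra ℝ A) : Subalgebra ℂ (Complexification A) :=
  (ofSubmodule (Subalgebra.toSubmodule U)).toSubalgebra ⟨one_mem U, zero_mem U⟩
    fun _ _ hz hw => ⟨U.sub_mem (U.mul_mem hz.1 hw.1) (U.mul_mem hz.2 hw.2),
      U.add_mem (U.mul_mem hz.1 hw.2) (U.mul_mem hz.2 hw.1)⟩

theorem toSubmodule_ofSubalgebra (U : Subalgebra ℝ A) :
    Subalgebra.toSubmodule (ofSubalgebra U) = ofSubmodule (Subalgebra.toSubmodule U) := rfl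

/-- The complexification of a real subalgebra, seen as a subalgebra of the complexification and as
a complexification. -/
def ofSubalgebraEquiv (U : Subalgebra ℝ A) : ofSubalgebra U ≃ₐ[ℂ] Complexification U where
  toFun z := ⟨⟨z.1.re, z.2.1⟩, ⟨z.1.im, z.2.2⟩⟩
  invFun w := ⟨⟨w.re, w.im⟩, w.re.2, w.im.2⟩
  left_inv _ := rfl
  right_inv _ := rfl
  map_mul' _ _ := rfl
  map_add' _ _ := rfl
  commutes' c := by
    rw [Algebra.algebraMap_eq_smul_one, Algebra.algebraMap_eq_smul_one]
    rfl

end Subalgebra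

section NormedRing

variable {A : Type*} [NormedRing A] [NormedAlgebra ℝ A] [Lattice A] [IsBanachLattice A]

/-- A crude bound by four real products. Any constant would do for inverse closedness, where the
other factor is made arbitrarily small. -/
theorem norm_mul_le_four_mul (z w : Complexification A) : ‖z * w‖ ≤ 4 * (‖z‖ * ‖w‖) := by
  have hm : ∀ a b : A, ‖a‖ ≤ ‖z‖ → ‖b‖ ≤ ‖w‖ → ‖a * b‖ ≤ ‖z‖ * ‖w‖ := fun a b ha hb =>
    (norm_mul_le a b).trans (mul_le_mul ha hb (norm_nonneg b) ((norm_nonneg a).trans ha))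
  have h1 := norm_sub_le (z.re * w.re) (z.im * w.im)
  have h2 := norm_add_le (z.re * w.im) (z.im * w.re)
  have h3 := hm _ _ (norm_re_le z) (norm_re_le w)
  have h4 := hm _ _ (norm_im_le z) (norm_im_le w)
  have h5 := hm _ _ (norm_re_le z) (norm_im_le w)
  have h6 := hm _ _ (norm_im_le z) (norm_re_le w)
  have h7 := norm_le_add (z * w)
  rw [mul_re, mul_im] at h7
  linarith

end NormedRing

end Complexification

/-! ### The complex ideal and its representation on `C(K, ℂ)` -/

namespace Complexification

open IsBanachLatticeAlgebra

section UnitIdeal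

variable {A : Type*} [NormedRing A] [NormedAlgebra ℝ A] [Lattice A] [IsBanachLatticeAlgebra A]
  [NormOneClass A]

theorem modulus_mem_unitIdeal {z : Complexification A} (hz : z ∈ ofSubalgebra (unitIdeal A)) :
    modulus z ∈ unitIdeal A := by
  obtain ⟨c, hc⟩ := hz.1
  obtain ⟨d, hd⟩ := hz.2
  refine mem_unitIdeal_of_nonneg (modulus_nonneg z) (c := c + d) ((modulus_le_add z).trans ?_)
  rw [add_smul]
  exact add_le_add hc hd

theorem isIdeal_ofSubalgebra_unitIdeal :
    IsIdeal (Subalgebra.toSubmodule (ofSubalgebra (unitIdeal A))) := by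
  intro z hz w hw
  have hm := modulus_mem_unitIdeal hz
  rw [← abs_of_nonneg (modulus_nonneg z)] at hw
  exact ⟨mem_unitIdeal_of_abs_le hm ((abs_re_le_modulus w).trans hw),
    mem_unitIdeal_of_abs_le hm ((abs_im_le_modulus w).trans hw)⟩

theorem idealGen_one_eq_ofSubalgebra :
    idealGen (1 : Complexification A) =
      Subalgebra.toSubmodule (ofSubalgebra (unitIdeal A)) := by
  refine le_antisymm
    (sInf_le ⟨isIdeal_ofSubalgebra_unitIdeal, one_mem (ofSubalgebra (unitIdeal A))⟩) (le_sInf ?_)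
  rintro I ⟨hI, h1⟩ z hz
  obtain ⟨c, hc0, hc⟩ := exists_pos_abs_le (modulus_mem_unitIdeal hz)
  refine hI _ (I.smul_mem (c : ℂ) h1) z ?_
  have h : (c : ℂ) • (1 : Complexification A) = ofReal (c • (1 : A)) := by
    ext <;> simp only [ofReal_re, ofReal_im, smul_re, smul_im, one_re, one_im, Complex.ofReal_re,
      Complex.ofReal_im] <;> module
  rw [h, modulus_ofReal_of_nonneg (smul_nonneg hc0.le zero_le_one)]
  exact (le_abs_self _).trans hc

/-- Every `c > ‖z‖` is admissible in the infimum by `abs_le_norm_smul_one`, and every admissible `c`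
is at least `‖z‖` by solidity of the norm. -/
theorem norm_eq_unitNorm {z : Complexification A} (hz : z ∈ ofSubalgebra (unitIdeal A)) :
    ‖z‖ = RealLattice.unitNorm (1 : A) (modulus z) := by
  have key : ∀ c : ℝ, ‖z‖ < c → c ∈ {c : ℝ | 0 < c ∧ |modulus z| ≤ c • (1 : A)} := fun c hc =>
    ⟨(norm_nonneg (modulus z)).trans_lt hc,
      (abs_le_norm_smul_one (modulus_mem_unitIdeal hz)).trans (smul_one_mono hc.le)⟩
  refine (csInf_eq_of_forall_ge_of_forall_gt_exists_lt ⟨‖z‖ + 1, key _ (lt_add_one _)⟩ ?_ ?_).symm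
  · exact fun c hc => norm_le_of_abs_le_smul_one hc.2 hc.1.le
  · intro c hc
    obtain ⟨d, hd, hd'⟩ := exists_between hc
    exact ⟨d, key d hd, hd'⟩

end UnitIdeal

section Representation

variable {B : Type*} [CommRing B] [Algebra ℝ B] {K : Type*} [TopologicalSpace K]
  (Φ : Complexification B ≃ₐ[ℂ] C(K, ℂ))

theorem algEquiv_apply (w : Complexification B) (t : K) :
    Φ w t = Φ (ofReal w.re) t + Complex.I * Φ (ofReal w.im) t := by
  have h : w = ofReal w.re + Complex.I • ofReal w.im := by ext <;> simp
  conv_lhs => rw [h]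
  rw [map_add, map_smul]
  rfl

variable {Φ}

theorem algEquiv_apply_re (him : ∀ x t, (Φ (ofReal x) t).im = 0) (w : Complexification B) (t : K) :
    (Φ w t).re = (Φ (ofReal w.re) t).re := by
  rw [algEquiv_apply]; simp [him]

theorem algEquiv_apply_im (him : ∀ x t, (Φ (ofReal x) t).im = 0) (w : Complexification B) (t : K) :
    (Φ w t).im = (Φ (ofReal w.im) t).re := by
  rw [algEquiv_apply]; simp [him]

theorem algEquiv_rotation_re (him : ∀ x t, (Φ (ofReal x) t).im = 0) (w : Complexification B)
    (φ : ℝ) (t : K) :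
    (Φ (ofReal (Real.cos φ • w.re + Real.sin φ • w.im)) t).re =
      Real.cos φ * (Φ w t).re + Real.sin φ * (Φ w t).im := by
  have h : ofReal (Real.cos φ • w.re + Real.sin φ • w.im) =
      ((Real.cos φ : ℝ) : ℂ) • ofReal w.re + ((Real.sin φ : ℝ) : ℂ) • ofReal w.im := by
    ext <;> simp only [ofReal_re, ofReal_im, smul_re, smul_im, add_re, add_im, Complex.ofReal_re,
      Complex.ofReal_im] <;> module
  rw [h, map_add, map_smul, map_smul, algEquiv_apply_re him w, algEquiv_apply_im him w,
    ContinuousMap.add_apply, ContinuousMap.smul_apply, ContinuousMap.smul_apply, Complex.add_re,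
    smul_eq_mul, smul_eq_mul, Complex.re_ofReal_mul, Complex.re_ofReal_mul]

theorem le_iff_forall_re_le [PartialOrder B] [IsOrderedAddMonoid B]
    (hord : ∀ x, 0 ≤ x ↔ ∀ t, 0 ≤ (Φ (ofReal x) t).re) (x y : B) :
    x ≤ y ↔ ∀ t, (Φ (ofReal x) t).re ≤ (Φ (ofReal y) t).re := by
  have h : ofReal (y - x) = ofReal y - ofReal x := by ext <;> simp
  rw [← sub_nonneg, hord, h, map_sub]
  simp only [ContinuousMap.sub_apply, Complex.sub_re, sub_nonneg]

end Representation

/-! ### Inverse closedness -/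

section InverseClosed

variable {A : Type*} [NormedRing A] [NormedAlgebra ℝ A] [Lattice A] [IsBanachLattice A]
  {K : Type*} [TopologicalSpace K]

/-- A subalgebra isometric to some `C(K, ℂ)` is inverse closed. -/
theorem isInverseClosed_of_isometric [CompactSpace K] {S : Subalgebra ℂ (Complexification A)}
    (Ψ : S ≃ₐ[ℂ] C(K, ℂ)) (hΨ : ∀ z : S, ‖Ψ z‖ = ‖(z : Complexification A)‖) :
    S.IsInverseClosed := by
  intro u hu
  set f := Ψ ⟨u, hu⟩ with hf
  have hne : ∀ t, f t ≠ 0 := by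
    intro t ht
    set M := ‖((u⁻¹ : (Complexification A)ˣ) : Complexification A)‖
    have hM : 0 ≤ M := norm_nonneg (modulus (u⁻¹ : (Complexification A)ˣ).1)
    obtain ⟨ε, hε, hεM⟩ : ∃ ε : ℝ, 0 < ε ∧ 4 * (ε * M) < 1 := by
      refine ⟨(4 * M + 1)⁻¹, by positivity, ?_⟩
      have : 4 * ((4 * M + 1)⁻¹ * M) = 4 * M / (4 * M + 1) := by ring
      rw [this, div_lt_one (by positivity)]
      linarith
    have hpos : ∀ s, 0 < ε + ‖f s‖ := fun s => by positivity
    -- The function `g` equals `1` at the zero `t` of `f`, while `|g f| ≤ ε` everywhere. For the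
    -- preimage `z` of `g` this gives `1 ≤ ‖z‖ = ‖(z u) u⁻¹‖ ≤ 4 ε M < 1`.
    let g : C(K, ℂ) := ⟨fun s => ((ε / (ε + ‖f s‖) : ℝ) : ℂ),
      Complex.continuous_ofReal.comp
        (continuous_const.div (by fun_prop) fun s => (hpos s).ne')⟩
    have hg : ∀ s, g s = ((ε / (ε + ‖f s‖) : ℝ) : ℂ) := fun _ => rfl
    obtain ⟨z, hz⟩ := Ψ.surjective g
    have h1 : 1 ≤ ‖(z : Complexification A)‖ := by
      rw [← hΨ, hz]
      refine le_trans (le_of_eq ?_) (g.norm_coe_le_norm t)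
      rw [hg, ht, norm_zero, add_zero, div_self hε.ne', Complex.ofReal_one, norm_one]
    have h2 : ‖(z : Complexification A) * (u : Complexification A)‖ ≤ ε := by
      have := hΨ (z * ⟨u, hu⟩)
      rw [map_mul, hz, ← hf] at this
      refine this.symm.trans_le ((ContinuousMap.norm_le _ hε.le).2 fun s => ?_)
      rw [ContinuousMap.mul_apply, norm_mul, hg, Complex.norm_real,
        Real.norm_of_nonneg (div_nonneg hε.le (hpos s).le), div_mul_eq_mul_div,
        div_le_iff₀ (hpos s)]
      nlinarith [norm_nonneg (f s)]
    have h3 := norm_mul_le_four_mul ((z : Complexification A) * (u : Complexification A))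
      ((u⁻¹ : (Complexification A)ˣ) : Complexification A)
    rw [Units.mul_inv_cancel_right] at h3
    nlinarith
  have hunit : IsUnit (⟨u, hu⟩ : S) :=
    (MulEquiv.isUnit_map Ψ).1 ((ContinuousMap.isUnit_iff_forall_ne_zero f).2 hne)
  obtain ⟨v, hv⟩ := hunit.exists_right_inv
  have hv' : (u : Complexification A) * v = 1 := congrArg Subtype.val hv
  rw [Units.inv_eq_of_mul_eq_one_right hv']
  exact v.2

end InverseClosed

/-! ### The modulus under the representation -/

section ModulusRepresentation

variable {A : Type*} [NormedRing A] [NormedAlgebra ℝ A] [Lattice A] [IsBanachLatticeAlgebra A]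
  [NormOneClass A] {K : Type*} [TopologicalSpace K]
  {Φ : Complexification (unitIdeal A) ≃ₐ[ℂ] C(K, ℂ)}

/-- The modulus is a supremum of rotations formed in `A`, so pointwise evaluation needs an argument:
the continuous function `|Φ w|` comes from an element of the ideal that bounds all rotations, and at
each point one rotation attains its value. -/
theorem algEquiv_modulus (him : ∀ x t, (Φ (ofReal x) t).im = 0)
    (hord : ∀ x, 0 ≤ x ↔ ∀ t, 0 ≤ (Φ (ofReal x) t).re) {z : Complexification A}
    (hz : z ∈ ofSubalgebra (unitIdeal A)) (t : K) :
    Φ (ofReal ⟨modulus z, modulus_mem_unitIdeal hz⟩) t =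
      (‖Φ (ofSubalgebraEquiv (unitIdeal A) ⟨z, hz⟩) t‖ : ℂ) := by
  set m : unitIdeal A := ⟨modulus z, modulus_mem_unitIdeal hz⟩
  set w : Complexification (unitIdeal A) := ofSubalgebraEquiv (unitIdeal A) ⟨z, hz⟩
  suffices h : (Φ (ofReal m) t).re = ‖Φ w t‖ by
    apply Complex.ext
    · rw [h, Complex.ofReal_re]
    · rw [him, Complex.ofReal_im]
  apply le_antisymm
  · obtain ⟨a, ha⟩ := Φ.surjective ⟨fun s => (‖Φ w s‖ : ℂ), by fun_prop⟩
    have ha' : ∀ s, (Φ (ofReal a.re) s).re = ‖Φ w s‖ := fun s => by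
      rw [← algEquiv_apply_re him a, ha]
      exact Complex.ofReal_re _
    have hle : m ≤ a.re := by
      refine modulus_le fun φ => ?_
      have : Real.cos φ • w.re + Real.sin φ • w.im ≤ a.re := by
        rw [le_iff_forall_re_le hord]
        intro s
        rw [ha', algEquiv_rotation_re him]
        refine le_of_sq_le_sq ?_ (norm_nonneg _)
        rw [Complex.sq_norm, Complex.normSq_apply]
        -- Uses `(a cos φ + b sin φ)² + (a sin φ - b cos φ)² = a² + b²`.
        nlinarith [Real.sin_sq_add_cos_sq φ, sq_nonneg
          (Real.sin φ * (Φ w s).re - Real.cos φ * (Φ w s).im)]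
      exact this
    exact ((le_iff_forall_re_le hord _ _).1 hle t).trans_eq (ha' t)
  -- Rotating by the argument of `Φ w t` makes the real part at `t` equal to `‖Φ w t‖`.
  · have hle : Real.cos (Φ w t).arg • w.re + Real.sin (Φ w t).arg • w.im ≤ m :=
      rotation_le_modulus z _
    have h := (le_iff_forall_re_le hord _ _).1 hle t
    rw [algEquiv_rotation_re him] at h
    refine le_trans (le_of_eq ?_) h
    linear_combination (-‖Φ w t‖) * Real.sin_sq_add_cos_sq (Φ w t).arg +
      Real.cos (Φ w t).arg * Complex.norm_mul_cos_arg (Φ w t) +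
      Real.sin (Φ w t).arg * Complex.norm_mul_sin_arg (Φ w t)

/-- Both norms depend only on the modulus, so the isometry on real elements, applied to `modulus z`,
suffices. -/
theorem norm_algEquiv [CompactSpace K] (him : ∀ x t, (Φ (ofReal x) t).im = 0)
    (hnorm : ∀ x, ‖Φ (ofReal x)‖ = ‖x‖) (hord : ∀ x, 0 ≤ x ↔ ∀ t, 0 ≤ (Φ (ofReal x) t).re)
    {z : Complexification A} (hz : z ∈ ofSubalgebra (unitIdeal A)) :
    ‖Φ (ofSubalgebraEquiv (unitIdeal A) ⟨z, hz⟩)‖ = ‖z‖ := by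
  have h := hnorm ⟨modulus z, modulus_mem_unitIdeal hz⟩
  rw [ContinuousMap.norm_eq_iSup_norm] at h ⊢
  simp only [algEquiv_modulus him hord hz, Complex.norm_real, norm_norm] at h
  exact h

end ModulusRepresentation

end Complexification

/-! ### Spectra and the main theorem -/

theorem Subalgebra.IsInverseClosed.spectrum_eq {R A : Type*} [CommRing R] [Ring A] [Algebra R A]
    {S : Subalgebra R A} (hS : S.IsInverseClosed) (a : S) : spectrum R (a : A) = spectrum R a := by
  ext r
  rw [spectrum.mem_iff, spectrum.mem_iff, not_iff_not]
  constructor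
  · rintro ⟨u, hu⟩
    have hu' : (u : A) = ((algebraMap R S r - a : S) : A) := hu
    have hmem : (u : A) ∈ S := hu' ▸ (algebraMap R S r - a).2
    refine ⟨⟨⟨u, hmem⟩, ⟨_, hS u hmem⟩, Subtype.ext u.mul_inv, Subtype.ext u.inv_mul⟩, ?_⟩
    exact Subtype.ext hu
  · intro h
    exact h.map S.val

open IsBanachLatticeAlgebra Complexification in
theorem theorem3 {A : Type u} [NormedRing A] [NormedAlgebra ℝ A] [Lattice A]
    [IsBanachLatticeAlgebra A] [NormOneClass A] :
    -- the ideal generated by the identity is the complexification of the real one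
    Complexification.idealGen (1 : Complexification A) =
        Complexification.ofSubmodule (RealLattice.idealGen (1 : A)) ∧
      -- it is a projection band
      Complexification.IsProjectionBand (Complexification.idealGen (1 : Complexification A)) ∧
      -- it is an inverse closed subalgebra
      ∃ S : Subalgebra ℂ (Complexification A),
        Subalgebra.toSubmodule S = Complexification.idealGen (1 : Complexification A) ∧
        S.IsInverseClosed ∧
        -- the three norms agree on it
        (∀ z ∈ S, ‖z‖ = RealLattice.unitNorm (1 : A) (Complexification.modulus z) ∧
          spectralRadius ℂ z = ENNReal.ofReal ‖z‖) ∧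
        -- it is `C(K, ℂ)`, isometrically, as an algebra and as a complex lattice
        ∃ (K : Type u) (_ : TopologicalSpace K) (_ : CompactSpace K) (_ : T2Space K)
          (Φ : S ≃ₐ[ℂ] C(K, ℂ)),
          (∀ z : S, ‖Φ z‖ = ‖(z : Complexification A)‖) ∧
          ∀ z : S, ∃ w : S,
            (w : Complexification A) =
              Complexification.ofReal (Complexification.modulus (z : Complexification A)) ∧
            ∀ t : K, Φ w t = (‖Φ z t‖ : ℂ) := by
  rw [idealGen_one_eq_ofSubalgebra, idealGen_one_eq_unitIdeal]
  refine ⟨rfl, ⟨isIdeal_ofSubalgebra_unitIdeal, ?_⟩, ofSubalgebra (unitIdeal A), rfl, ?_⟩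
  · rw [toSubmodule_ofSubalgebra, interReal_ofSubmodule]
    exact isProjectionBand_unitIdeal
  obtain ⟨K, _, _, _, Φ, him, hnorm, hord⟩ := exists_algEquiv_continuousMap (unitIdeal A)
  let Ψ : ofSubalgebra (unitIdeal A) ≃ₐ[ℂ] C(K, ℂ) := (ofSubalgebraEquiv (unitIdeal A)).trans Φ
  have hΨ : ∀ z : ofSubalgebra (unitIdeal A), ‖Ψ z‖ = ‖(z : Complexification A)‖ :=
    fun z => norm_algEquiv him hnorm hord z.2
  have hinv := isInverseClosed_of_isometric Ψ hΨ
  refine ⟨hinv, fun z hz => ⟨norm_eq_unitNorm hz, ?_⟩, K, inferInstance, inferInstance,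
    inferInstance, Ψ, hΨ, fun z => ?_⟩
  -- Every element of `C(K, ℂ)` is normal, so its spectral radius is its norm. The spectrum is
  -- carried back by `Ψ`, and inverse closedness identifies it with the spectrum in the whole
  -- complexification.
  · have h := IsStarNormal.spectralRadius_eq_nnnorm (Ψ ⟨z, hz⟩)
    rw [spectralRadius, AlgEquiv.spectrum_eq Ψ, ← hinv.spectrum_eq] at h
    rw [← hΨ ⟨z, hz⟩, ofReal_norm]
    exact h
  · exact ⟨⟨ofReal (modulus z), modulus_mem_unitIdeal z.2, zero_mem _⟩, rfl,
      algEquiv_modulus him hord z.2⟩
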